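/- Let $G = F(a,b)\times F(c,d)$ be the direct product of two free groups of rank two. For a finite generating set $A$ of $G$, let $\mathrm{Cay}(G,A)$ be the Cayley graph (vertices $G$, edges $\{g,gs\}$ for $g\in G$, $s\in A$), regarded as a geodesic metric space with all edges of length one. A metric space $X$ is called strongly shortcut if there exist $L\ge 0$ and $\lambda<1$ such that for every rectifiable loop $\rho:[0,1]\to X$, $\rho(0)=\rho(1)$, of length $\ell\ge L$, there are $0\le p\le q\le 1$ and a path $\mu$ in $X$ from $\rho(p)$ to $\rho(q)$ such that each of the two loops into which $\mu$ subdivides $\rho$ (the one made of $\rho|_{[p,q]}$ and $\mu$, and the one made of $\rho|_{[q,1]\cup[0,p]}$ and $\mu$) has length at most $\lambda\ell$. Then: 1. $\mathrm{Cay}(G,\{a,b,c,d\})$ is strongly shortcut. 2. $\mathrm{Cay}(G,\{a,b,c,db^{-1}\})$ is not strongly shortcut. Moreover, with $t=db^{-1}$, for every integer $n\ge 0$ the word $w_n=[t^nct^{-n},a]=t^nct^{-n}a\,t^nc^{-1}t^{-n}a^{-1}$, of length $4n+4$, represents $1$ in $G$, and the closed edge path from $1$ that reads $w_n$ is an isometrically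 embedded circle of circumference $4n+4$ in $\mathrm{Cay}(G,\{a,b,c,t\})$. -/

import Mathlib

open scoped ENNReal unitInterval

/-! ### The geodesic metric space of a connected graph -/

/-- A representative of a point of the geometric realization of the graph `Γ` (all of whose edges
have length one): the point at distance `pos` from `fst` on the edge from `fst` to `snd`.
We also allow `fst = snd`, in which case `pos = 0` and the point is the vertex itself. -/
structure EdgePoint {V : Type*} (Γ : SimpleGraph V) where
  fst : V
  snd : V
  adj_or_eq : Γ.Adj fst snd ∨ fst = snd
  pos : ℝ
  pos_nonneg : 0 ≤ pos
  pos_le : pos ≤ Γ.dist fst snd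

namespace EdgePoint

variable {V : Type*} {Γ : SimpleGraph V}

/-- The distance, inside the edge, from a point to the second endpoint of its edge. -/
noncomputable def copos (p : EdgePoint Γ) : ℝ := Γ.dist p.fst p.snd - p.pos

/-- The length of a shortest path from `p` to `q` among those which leave the edge of `p` through
one of its endpoints, and enter the edge of `q` through one of its endpoints. -/
noncomputable def outerDist (p q : EdgePoint Γ) : ℝ :=
  min (min (p.pos + Γ.dist p.fst q.fst + q.pos) (p.pos + Γ.dist p.fst q.snd + q.copos))
    (min (p.copos + Γ.dist p.snd q.fst + q.pos) (p.copos + Γ.dist p.snd q.snd + q.copos))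

open Classical in
/-- The path metric: two points of the same edge (with the same or with opposite orientations) are
joined by a segment of this edge, and other points are joined through endpoints of their edges. -/
noncomputable def pathDist (p q : EdgePoint Γ) : ℝ :=
  if p.fst = q.fst ∧ p.snd = q.snd then |p.pos - q.pos|
  else if p.fst = q.snd ∧ p.snd = q.fst then |p.pos - q.copos|
  else outerDist p q

theorem copos_nonneg (p : EdgePoint Γ) : 0 ≤ p.copos := sub_nonneg.2 p.pos_le

theorem pos_add_copos (p : EdgePoint Γ) : p.pos + p.copos = Γ.dist p.fst p.snd := by
  simp [copos]

theorem pathDist_le (p q : EdgePoint Γ) :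
    pathDist p q ≤ p.pos + Γ.dist p.fst q.fst + q.pos ∧
    pathDist p q ≤ p.pos + Γ.dist p.fst q.snd + q.copos ∧
    pathDist p q ≤ p.copos + Γ.dist p.snd q.fst + q.pos ∧
    pathDist p q ≤ p.copos + Γ.dist p.snd q.snd + q.copos := by
  have hp := p.pos_nonneg
  have hq := q.pos_nonneg
  have hp' := p.copos_nonneg
  have hq' := q.copos_nonneg
  have sp := p.pos_add_copos
  have sq := q.pos_add_copos
  unfold pathDist
  split_ifs with h1 h2
  · obtain ⟨e1, e2⟩ := h1
    have hc : (Γ.dist q.snd q.fst : ℝ) = Γ.dist q.fst q.snd := by rw [SimpleGraph.dist_comm]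
    rw [e1, e2] at sp
    rw [e1, e2, hc]
    simp only [SimpleGraph.dist_self, Nat.cast_zero]
    refine ⟨?_, ?_, ?_, ?_⟩ <;> rw [abs_le] <;> constructor <;> linarith
  · obtain ⟨e1, e2⟩ := h2
    have hc : (Γ.dist q.snd q.fst : ℝ) = Γ.dist q.fst q.snd := by rw [SimpleGraph.dist_comm]
    rw [e1, e2, hc] at sp
    rw [e1, e2, hc]
    simp only [SimpleGraph.dist_self, Nat.cast_zero]
    refine ⟨?_, ?_, ?_, ?_⟩ <;> rw [abs_le] <;> constructor <;> linarith
  · unfold outerDist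
    refine ⟨?_, ?_, ?_, ?_⟩ <;> simp

theorem pathDist_cases (p q : EdgePoint Γ) :
    (p.fst = q.fst ∧ p.snd = q.snd ∧ pathDist p q = |p.pos - q.pos|) ∨
    (p.fst = q.snd ∧ p.snd = q.fst ∧ pathDist p q = |p.pos - q.copos|) ∨
    pathDist p q = p.pos + Γ.dist p.fst q.fst + q.pos ∨
    pathDist p q = p.pos + Γ.dist p.fst q.snd + q.copos ∨
    pathDist p q = p.copos + Γ.dist p.snd q.fst + q.pos ∨
    pathDist p q = p.copos + Γ.dist p.snd q.snd + q.copos := by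
  by_cases h1 : p.fst = q.fst ∧ p.snd = q.snd
  · left
    exact ⟨h1.1, h1.2, by simp [pathDist, h1]⟩
  by_cases h2 : p.fst = q.snd ∧ p.snd = q.fst
  · right; left
    exact ⟨h2.1, h2.2, by rw [pathDist, if_neg h1, if_pos h2]⟩
  right; right
  rw [pathDist, if_neg h1, if_neg h2, outerDist]
  rcases min_choice (min (p.pos + Γ.dist p.fst q.fst + q.pos)
      (p.pos + Γ.dist p.fst q.snd + q.copos))
    (min (p.copos + Γ.dist p.snd q.fst + q.pos) (p.copos + Γ.dist p.snd q.snd + q.copos))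
    with h | h <;> rw [h]
  · rcases min_choice (p.pos + Γ.dist p.fst q.fst + q.pos)
      (p.pos + Γ.dist p.fst q.snd + q.copos) with h' | h' <;> simp [h']
  · rcases min_choice (p.copos + Γ.dist p.snd q.fst + q.pos)
      (p.copos + Γ.dist p.snd q.snd + q.copos) with h' | h' <;> simp [h']

theorem pathDist_same {p q : EdgePoint Γ} (h1 : p.fst = q.fst) (h2 : p.snd = q.snd) :
    pathDist p q = |p.pos - q.pos| := by
  simp [pathDist, h1, h2]

theorem copos_same {p q : EdgePoint Γ} (h1 : p.fst = q.fst) (h2 : p.snd = q.snd) :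
    p.pos + p.copos = q.pos + q.copos := by
  rw [p.pos_add_copos, q.pos_add_copos, h1, h2]

theorem copos_opp {p q : EdgePoint Γ} (h1 : p.fst = q.snd) (h2 : p.snd = q.fst) :
    p.pos + p.copos = q.pos + q.copos := by
  rw [p.pos_add_copos, q.pos_add_copos, h1, h2, SimpleGraph.dist_comm]

theorem pathDist_opp {p q : EdgePoint Γ} (h1 : p.fst = q.snd) (h2 : p.snd = q.fst) :
    pathDist p q = |p.pos - q.copos| := by
  by_cases h : p.fst = q.fst ∧ p.snd = q.snd
  · have h0 : Γ.dist q.fst q.snd = 0 := by rw [← h.1, h1]; simp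
    have sp := copos_opp h1 h2
    have sq := q.pos_add_copos
    rw [h0, Nat.cast_zero] at sq
    rw [pathDist_same h.1 h.2]
    have := p.pos_nonneg
    have := q.pos_nonneg
    have := p.copos_nonneg
    have := q.copos_nonneg
    congr 1
    linarith
  · rw [pathDist, if_neg h, if_pos ⟨h1, h2⟩]

theorem pathDist_self (p : EdgePoint Γ) : pathDist p p = 0 := by simp [pathDist]

theorem pathDist_comm_le (p q : EdgePoint Γ) : pathDist p q ≤ pathDist q p := by
  have hc : ∀ u v : V, (Γ.dist u v : ℝ) = Γ.dist v u := fun u v => by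
    rw [SimpleGraph.dist_comm]
  obtain ⟨l1, l2, l3, l4⟩ := pathDist_le p q
  rcases pathDist_cases q p with ⟨e1, e2, h⟩ | ⟨e1, e2, h⟩ | h | h | h | h
  · rw [h, pathDist_same e1.symm e2.symm, abs_sub_comm]
  · rw [h, pathDist_opp e2.symm e1.symm]
    have s := copos_opp e1 e2
    apply le_of_eq
    congr 1
    linarith
  all_goals rw [h, hc]; linarith

theorem pathDist_triangle (hΓ : Γ.Connected) (p q r : EdgePoint Γ) :
    pathDist p r ≤ pathDist p q + pathDist q r := by
  have hc : ∀ u v : V, (Γ.dist u v : ℝ) = Γ.dist v u := fun u v => by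
    rw [SimpleGraph.dist_comm]
  have ht : ∀ u v w : V, (Γ.dist u w : ℝ) ≤ Γ.dist u v + Γ.dist v w := fun u v w => by
    exact_mod_cast hΓ.dist_triangle
  have q0 := q.pos_nonneg
  have q1 := q.copos_nonneg
  have sq := q.pos_add_copos
  obtain ⟨l1, l2, l3, l4⟩ := pathDist_le p r
  rcases pathDist_cases p q with ⟨e1, e2, h⟩ | ⟨e1, e2, h⟩ | h
  · have sp := copos_same e1 e2
    have a1 := le_abs_self (p.pos - q.pos)
    have a2 := neg_abs_le (p.pos - q.pos)
    rcases pathDist_cases q r with ⟨f1, f2, k⟩ | ⟨f1, f2, k⟩ | k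
    · rw [pathDist_same (e1.trans f1) (e2.trans f2), h, k]
      exact abs_sub_le _ _ _
    · rw [pathDist_opp (e1.trans f1) (e2.trans f2), h, k]
      exact abs_sub_le _ _ _
    · rw [e1] at l1 l2
      rw [e2] at l3 l4
      rcases k with k | k | k | k <;> linarith
  · have sp := copos_opp e1 e2
    have a1 := le_abs_self (p.pos - q.copos)
    have a2 := neg_abs_le (p.pos - q.copos)
    rcases pathDist_cases q r with ⟨f1, f2, k⟩ | ⟨f1, f2, k⟩ | k
    · have sr := copos_same f1 f2
      rw [pathDist_opp (e1.trans f2) (e2.trans f1), h, k]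
      have : q.pos - r.pos = -(q.copos - r.copos) := by linarith
      rw [this, abs_neg]
      exact abs_sub_le _ _ _
    · have sr := copos_opp f1 f2
      rw [pathDist_same (e1.trans f2) (e2.trans f1), h, k]
      have : q.pos - r.copos = -(q.copos - r.pos) := by linarith
      rw [this, abs_neg]
      exact abs_sub_le _ _ _
    · rw [e1] at l1 l2
      rw [e2] at l3 l4
      rcases k with k | k | k | k <;> linarith
  · rcases pathDist_cases q r with ⟨f1, f2, k⟩ | ⟨f1, f2, k⟩ | k
    · have sr := copos_same f1 f2
      have a1 := le_abs_self (q.pos - r.pos)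
      have a2 := neg_abs_le (q.pos - r.pos)
      rw [← f1] at l1 l3
      rw [← f2] at l2 l4
      rcases h with h | h | h | h <;> linarith
    · have sr := copos_opp f1 f2
      have a1 := le_abs_self (q.pos - r.copos)
      have a2 := neg_abs_le (q.pos - r.copos)
      rw [← f1] at l2 l4
      rw [← f2] at l1 l3
      rcases h with h | h | h | h <;> linarith
    · have hs := hc q.snd q.fst
      rcases h with h | h | h | h <;> rcases k with k | k | k | k
      all_goals
        first
        | linarith [ht p.fst q.fst r.fst]
        | linarith [ht p.fst q.fst r.snd]
        | linarith [ht p.snd q.fst r.fst]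
        | linarith [ht p.snd q.fst r.snd]
        | linarith [ht p.fst q.snd r.fst]
        | linarith [ht p.fst q.snd r.snd]
        | linarith [ht p.snd q.snd r.fst]
        | linarith [ht p.snd q.snd r.snd]
        | linarith [ht p.fst q.fst r.fst, ht q.fst q.snd r.fst]
        | linarith [ht p.fst q.fst r.snd, ht q.fst q.snd r.snd]
        | linarith [ht p.snd q.fst r.fst, ht q.fst q.snd r.fst]
        | linarith [ht p.snd q.fst r.snd, ht q.fst q.snd r.snd]
        | linarith [ht p.fst q.snd r.fst, ht q.snd q.fst r.fst]
        | linarith [ht p.fst q.snd r.snd, ht q.snd q.fst r.snd]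
        | linarith [ht p.snd q.snd r.fst, ht q.snd q.fst r.fst]
        | linarith [ht p.snd q.snd r.snd, ht q.snd q.fst r.snd]

noncomputable instance [hΓ : Fact Γ.Connected] : PseudoMetricSpace (EdgePoint Γ) where
  dist := pathDist
  dist_self := pathDist_self
  dist_comm p q := le_antisymm (pathDist_comm_le p q) (pathDist_comm_le q p)
  dist_triangle := pathDist_triangle hΓ.out

end EdgePoint

/-- The connected graph `Γ` as a geodesic metric space whose edges have length one: the
representatives of points, with representatives at distance zero identified. -/
abbrev GraphSpace {V : Type*} (Γ : SimpleGraph V) [Fact Γ.Connected] : Type _ :=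
  SeparationQuotient (EdgePoint Γ)

/-- The vertex `v`, as a point of the metric space of the graph. -/
noncomputable def GraphSpace.vertex {V : Type*} (Γ : SimpleGraph V) [Fact Γ.Connected] (v : V) :
    GraphSpace Γ :=
  SeparationQuotient.mk
    { fst := v, snd := v, adj_or_eq := Or.inr rfl, pos := 0, pos_nonneg := le_rfl,
      pos_le := Nat.cast_nonneg _ }

/-! ### The strong shortcut property -/

/-- The length of the restriction of the path `ρ` to the interval `[p, q]`. -/
noncomputable def pathLengthOn {X : Type*} [PseudoEMetricSpace X] {x y : X} (ρ : Path x y)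
    (p q : I) : ℝ≥0∞ :=
  eVariationOn ρ (Set.Icc p q)

/-- A metric space is strongly shortcut when there are `L ≥ 0` and `lam < 1` such that every
loop `ρ` of (finite) length `ℓ ≥ L` can be subdivided by a path `μ` from a point `ρ p` to a point
`ρ q`, with `p ≤ q`, into two loops of length at most `lam * ℓ`: one made of `ρ` on `[p, q]` and
`μ`, and one made of `ρ` on `[q, 1]`, `ρ` on `[0, p]` and `μ`. -/
def StronglyShortcut (X : Type*) [MetricSpace X] : Prop :=
  ∃ L : ℝ, 0 ≤ L ∧ ∃ lam : ℝ, lam < 1 ∧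
    ∀ (x : X) (ρ : Path x x),
      pathLengthOn ρ 0 1 ≠ ∞ → ENNReal.ofReal L ≤ pathLengthOn ρ 0 1 →
      ∃ (p q : I) (_ : p ≤ q) (μ : Path (ρ p) (ρ q)),
        pathLengthOn ρ p q + pathLengthOn μ 0 1
          ≤ ENNReal.ofReal lam * pathLengthOn ρ 0 1 ∧
        pathLengthOn ρ q 1 + pathLengthOn ρ 0 p + pathLengthOn μ 0 1
          ≤ ENNReal.ofReal lam * pathLengthOn ρ 0 1

/-! ### Cycles in Cayley graphs -/

/-- The word `w` in the group `G` represents `1`, and the closed edge path that starts at `1` and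
reads `w` is an isometric embedding into the graph `Γ` (with vertex set `G`) of the circle of
circumference `|w|` with its arc length metric. -/
def DefinesIsometricCycle {G : Type*} [Group G] (Γ : SimpleGraph G) [Fact Γ.Connected]
    (w : List G) : Prop :=
  w.prod = 1 ∧ ∃ γ : AddCircle (w.length : ℝ) → GraphSpace Γ, Isometry γ ∧
    ∀ i : ℕ, i ≤ w.length → γ ((i : ℝ) : AddCircle (w.length : ℝ)) =
      GraphSpace.vertex Γ (w.take i).prod

theorem mulCayley_connected {G : Type*} [Group G] {S : Set G} (hS : Subgroup.closure S = ⊤) :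
    (SimpleGraph.mulCayley S).Connected := by
  have key : ∀ g : G, ∀ s ∈ S, (SimpleGraph.mulCayley S).Reachable g (g * s) := by
    intro g s hs
    by_cases h : g = g * s
    · rw [← h]
    · exact SimpleGraph.Adj.reachable
        ((SimpleGraph.mulCayley_adj' S _ _).2 ⟨h, s, hs, Or.inl rfl⟩)
  have all : ∀ g : G, (SimpleGraph.mulCayley S).Reachable 1 g := by
    intro g
    have hg : g ∈ Subgroup.closure S := by rw [hS]; trivial
    induction hg using Subgroup.closure_induction_right with
    | one => exact SimpleGraph.Reachable.refl _
    | mul_right x _ y hy ih => exact ih.trans (key x y hy)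
    | mul_inv_cancel x _ y hy ih =>
      refine ih.trans ?_
      have := key (x * y⁻¹) y hy
      rw [inv_mul_cancel_right] at this
      exact this.symm
  have : Nonempty G := ⟨1⟩
  exact ⟨fun u v => (all u).symm.trans (all v)⟩

/-! ### The product of two free groups of rank two -/

/-- The group `F(a, b) × F(c, d)`. -/
abbrev FreeProd : Type := FreeGroup (Fin 2) × FreeGroup (Fin 2)

namespace FreeProd

def a : FreeProd := (FreeGroup.of 0, 1)

def b : FreeProd := (FreeGroup.of 1, 1)

def c : FreeProd := (1, FreeGroup.of 0)

def d : FreeProd := (1, FreeGroup.of 1)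

/-- The element `t = d b⁻¹`. -/
def t : FreeProd := d * b⁻¹

/-- The word `[tⁿ c t⁻ⁿ, a] = tⁿ c t⁻ⁿ a tⁿ c⁻¹ t⁻ⁿ a⁻¹` on `{a, b, c, t}`. -/
def word (n : ℕ) : List FreeProd :=
  List.replicate n t ++ [c] ++ List.replicate n t⁻¹ ++ [a] ++
    List.replicate n t ++ [c⁻¹] ++ List.replicate n t⁻¹ ++ [a⁻¹]

theorem closure_abcd : Subgroup.closure ({a, b, c, d} : Set FreeProd) = ⊤ := by
  set H := Subgroup.closure ({a, b, c, d} : Set FreeProd) with hH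
  have hl : ∀ x : FreeGroup (Fin 2), ((x, 1) : FreeProd) ∈ H := by
    intro x
    have : Subgroup.closure (Set.range (FreeGroup.of : Fin 2 → _)) ≤
        H.comap (MonoidHom.inl (FreeGroup (Fin 2)) (FreeGroup (Fin 2))) := by
      rw [Subgroup.closure_le]
      rintro _ ⟨i, rfl⟩
      apply Subgroup.subset_closure
      fin_cases i <;> simp [a, b, c, d]
    rw [FreeGroup.closure_range_of] at this
    exact this (Subgroup.mem_top x)
  have hr : ∀ x : FreeGroup (Fin 2), ((1, x) : FreeProd) ∈ H := by
    intro x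
    have : Subgroup.closure (Set.range (FreeGroup.of : Fin 2 → _)) ≤
        H.comap (MonoidHom.inr (FreeGroup (Fin 2)) (FreeGroup (Fin 2))) := by
      rw [Subgroup.closure_le]
      rintro _ ⟨i, rfl⟩
      apply Subgroup.subset_closure
      fin_cases i <;> simp [a, b, c, d]
    rw [FreeGroup.closure_range_of] at this
    exact this (Subgroup.mem_top x)
  rw [eq_top_iff]
  rintro ⟨x, y⟩ -
  have := H.mul_mem (hl x) (hr y)
  simpa using this

theorem closure_abct : Subgroup.closure ({a, b, c, d * b⁻¹} : Set FreeProd) = ⊤ := by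
  rw [eq_top_iff, ← closure_abcd, Subgroup.closure_le]
  have hb : b ∈ Subgroup.closure ({a, b, c, d * b⁻¹} : Set FreeProd) :=
    Subgroup.subset_closure (by simp)
  rintro x (rfl | rfl | rfl | rfl)
  · exact Subgroup.subset_closure (by simp)
  · exact hb
  · exact Subgroup.subset_closure (by simp)
  · have ht : d * b⁻¹ ∈ Subgroup.closure ({a, b, c, d * b⁻¹} : Set FreeProd) :=
      Subgroup.subset_closure (by simp)
    have := mul_mem ht hb
    rwa [inv_mul_cancel_right] at this

instance : Fact (SimpleGraph.mulCayley ({a, b, c, d} : Set FreeProd)).Connected :=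
  ⟨mulCayley_connected closure_abcd⟩

instance : Fact (SimpleGraph.mulCayley ({a, b, c, d * b⁻¹} : Set FreeProd)).Connected :=
  ⟨mulCayley_connected closure_abct⟩

end FreeProd

/-! For the standard generators the graph metric is the ℓ¹-sum of two tree metrics. Cut a long loop
into eight arcs of equal length. If no two cut points give a shortcut, they form, up to a small
error, an octagon with the distances of a circle (`stronglyShortcut_of_octagon`). Trees satisfy the
four-point condition, so in each factor one pair of opposite sides of the quadrilateral 0, 2, 4, 6
nearly collapses (`short_side_of_four_point`); the two factors collapse different pairs, since no
side is short in the sum. Four points alone would not suffice, because the corners of an ℓ¹-square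
look like this. Comparison with the quadrilateral 1, 2, 5, 6 gives the contradiction
(`not_octagon_of_four_point`).

With t = d b⁻¹, opposite vertices of the cycle of w_n differ by (b^i a b^-i, d^k c^±1 d^-k) with i +
k = n. A path between them crosses an a-edge of the first tree at relative b-exponent i, and a
c-edge of the second tree at relative d-exponent k; each crossing fixes the other coordinate. Let β
and δ be the exponent sums of b and d. The generator b changes only β + δ, and t changes only δ, so
|Δ(β + δ)| + |Δδ| bounds length from below, and a and c do not contribute to it. A closed tour from
(0, 0) that meets the lines β = i and δ = k costs at least 2i + 2k; with the two crossings this is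
2n + 2, half the circumference (`le_dist_self_mul`). Opposite vertices at full distance make the
cycle isometric (`exists_isometry_addCircle`), and arbitrarily long isometric circles exclude the
strong shortcut property (`not_stronglyShortcut_of_isometry_addCircle`). -/

/-! ### The word metric of a free group -/

namespace FreeGroup

variable {α : Type*} [DecidableEq α]

/-- The length of the longest common prefix of two words. -/
def commonPrefixLength : List (α × Bool) → List (α × Bool) → ℕ
  | x :: l, y :: m => if x = y then commonPrefixLength l m + 1 else 0
  | _, _ => 0

/-- This ultrametric inequality is the source of the four-point condition. -/
theorem min_commonPrefixLength_le : ∀ l m k : List (α × Bool),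
    min (commonPrefixLength l m) (commonPrefixLength m k) ≤ commonPrefixLength l k
  | [], _, _ => by simp [commonPrefixLength]
  | _ :: _, [], _ => by simp [commonPrefixLength]
  | _ :: _, _ :: _, [] => by simp [commonPrefixLength]
  | x :: l, y :: m, z :: k => by
    have := min_commonPrefixLength_le l m k
    simp only [commonPrefixLength]
    split_ifs <;> first | omega | (exfalso; simp_all)

theorem IsReduced.invRev {l : List (α × Bool)} (h : IsReduced l) :
    IsReduced (FreeGroup.invRev l) := by
  rw [isReduced_iff_reduce_eq] at h ⊢
  rw [reduce_invRev, h]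

/-- The cancellation in l⁻¹m consumes exactly the common prefix. After it is removed, the two first
letters differ, so nothing cancels at the junction. -/
theorem length_reduce_invRev_append : ∀ l m : List (α × Bool), IsReduced l → IsReduced m →
    (reduce (invRev l ++ m)).length + 2 * commonPrefixLength l m = l.length + m.length
  | [], m, _, hm => by simp [commonPrefixLength, hm.reduce_eq]
  | x :: l, [], hl, _ => by
    have := hl.invRev.reduce_eq
    simp [commonPrefixLength, this]
  | x :: l, y :: m, hl, hm => by
    by_cases hxy : x = y
    · subst hxy
      have ih := length_reduce_invRev_append l m (hl.infix (List.suffix_cons x l).isInfix)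
        (hm.infix (List.suffix_cons x m).isInfix)
      have : reduce (invRev (x :: l) ++ x :: m) = reduce (invRev l ++ m) := by
        apply reduce.Step.eq
        rw [invRev_cons]
        simp only [invRev, List.map_cons, List.map_nil, List.reverse_cons, List.reverse_nil,
          List.nil_append, List.append_assoc, List.cons_append]
        have := @Red.Step.not _ ((List.map (fun g : α × Bool => (g.1, !g.2)) l).reverse) m x.1 (!x.2)
        simpa using this
      rw [this]
      simp only [commonPrefixLength, if_true, List.length_cons]
      omega
    · have hr : IsReduced (invRev (x :: l) ++ y :: m) := by
        refine List.isChain_append.2 ⟨hl.invRev, hm, ?_⟩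
        intro u hu v hv huv
        simp only [invRev, List.map_cons, List.reverse_cons, List.getLast?_append,
          List.getLast?_singleton, Option.some_or, Option.mem_def, Option.some.injEq] at hu
        simp only [List.head?_cons, Option.mem_def, Option.some.injEq] at hv
        subst hu hv
        by_contra hne
        apply hxy
        ext
        · exact huv
        · revert hne; cases x.2 <;> cases y.2 <;> simp
      simp [hr.reduce_eq, commonPrefixLength, hxy]

/-- The distance of two elements of a free group in the Cayley graph of the free basis. -/
def wordDist (x y : FreeGroup α) : ℕ := norm (x⁻¹ * y)

theorem wordDist_add_commonPrefixLength (x y : FreeGroup α) :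
    wordDist x y + 2 * commonPrefixLength x.toWord y.toWord = norm x + norm y := by
  rw [wordDist, norm, toWord_mul, toWord_inv]
  exact length_reduce_invRev_append _ _ isReduced_toWord isReduced_toWord

theorem wordDist_self (x : FreeGroup α) : wordDist x x = 0 := by simp [wordDist]

theorem wordDist_one_left (x : FreeGroup α) : wordDist 1 x = norm x := by simp [wordDist]

theorem wordDist_mul_left (g x y : FreeGroup α) : wordDist (g * x) (g * y) = wordDist x y := by
  simp [wordDist, mul_assoc]

theorem wordDist_self_mul (x y : FreeGroup α) : wordDist x (x * y) = norm y := by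
  simp [wordDist]

theorem wordDist_comm (x y : FreeGroup α) : wordDist x y = wordDist y x := by
  rw [wordDist, ← norm_inv_eq, wordDist]
  simp

theorem wordDist_triangle (x y z : FreeGroup α) : wordDist x z ≤ wordDist x y + wordDist y z := by
  have := norm_mul_le (x⁻¹ * y) (y⁻¹ * z)
  simpa [wordDist, mul_assoc] using this

theorem wordDist_eq_zero {x y : FreeGroup α} : wordDist x y = 0 ↔ x = y := by
  rw [wordDist, norm_eq_zero, inv_mul_eq_one]

/-- After translating `w` to 1, the common prefix length is the Gromov product at 1, and its
ultrametric inequality says that the tree is 0-hyperbolic. -/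
theorem wordDist_four_point (w x y z : FreeGroup α) :
    wordDist x z + wordDist w y ≤
      max (wordDist x y + wordDist w z) (wordDist y z + wordDist w x) := by
  rw [← wordDist_mul_left w⁻¹ x z, ← wordDist_mul_left w⁻¹ w y, ← wordDist_mul_left w⁻¹ x y,
    ← wordDist_mul_left w⁻¹ w z, ← wordDist_mul_left w⁻¹ y z, ← wordDist_mul_left w⁻¹ w x,
    inv_mul_cancel, wordDist_one_left, wordDist_one_left, wordDist_one_left]
  have h1 := wordDist_add_commonPrefixLength (w⁻¹ * x) (w⁻¹ * y)
  have h2 := wordDist_add_commonPrefixLength (w⁻¹ * y) (w⁻¹ * z)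
  have h3 := wordDist_add_commonPrefixLength (w⁻¹ * x) (w⁻¹ * z)
  have h4 := min_commonPrefixLength_le (w⁻¹ * x).toWord (w⁻¹ * y).toWord (w⁻¹ * z).toWord
  omega

/-- An edge that leads from one side of the edge from `p` to `q` to the other is this edge. -/
theorem eq_of_wordDist_crossing {p q x y : FreeGroup α} (hpq : wordDist p q = 1)
    (hxy : wordDist x y = 1) (hx : wordDist p x ≤ wordDist q x)
    (hy : wordDist q y < wordDist p y) : x = p ∧ y = q := by
  have e1 := wordDist_add_commonPrefixLength p q
  have e2 := wordDist_add_commonPrefixLength p x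
  have e3 := wordDist_add_commonPrefixLength q x
  have e4 := wordDist_add_commonPrefixLength p y
  have e5 := wordDist_add_commonPrefixLength q y
  have t1 := wordDist_triangle p x y
  have t2 := wordDist_triangle q y x
  rw [wordDist_comm y x] at t2
  -- Distances to `p` and `q` have opposite parity, so both comparisons are strict by exactly one.
  -- The left side is then `wordDist p x + wordDist q y + 2`, which exceeds the first term of the
  -- maximum; the second term is 2, so both distances vanish.
  have f := wordDist_four_point p q y x
  rw [wordDist_comm y x] at f
  rw [← wordDist_eq_zero, ← wordDist_eq_zero, wordDist_comm x p, wordDist_comm y q]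
  omega

/-- The sum of the values of an integer-valued weight on the letters of a word. -/
def weight (v : α → ℤ) : FreeGroup α →* Multiplicative ℤ :=
  lift fun i => Multiplicative.ofAdd (v i)

@[simp] theorem weight_of {α : Type*} (v : α → ℤ) (i : α) :
    (weight v (of i)).toAdd = v i := by simp [weight]

theorem abs_weight_le (v : α → ℤ) (hv : ∀ i, |v i| ≤ 1) (x : FreeGroup α) :
    |(weight v x).toAdd| ≤ norm x := by
  have key : ∀ l : List (α × Bool), |(weight v (mk l)).toAdd| ≤ l.length := by
    intro l
    induction l with
    | nil => simp [← one_eq_mk]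
    | cons a l ih =>
      have : mk (a :: l) = mk [a] * mk l := by simp [mul_mk]
      rw [this, MonoidHom.map_mul, toAdd_mul, List.length_cons]
      refine (abs_add_le _ _).trans ?_
      have : |(weight v (mk [a])).toAdd| ≤ 1 := by
        obtain ⟨i, e⟩ := a
        have := hv i
        cases e <;> simpa [weight]
      push_cast
      omega
  simpa [mk_toWord, norm] using key x.toWord

end FreeGroup

/-! ### Lengths of paths -/

section PathLength

variable {X : Type*} [PseudoEMetricSpace X] {x y z : X}

theorem pathLengthOn_add (ρ : Path x y) {p q r : I} (hpq : p ≤ q) (hqr : q ≤ r) :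
    pathLengthOn ρ p q + pathLengthOn ρ q r = pathLengthOn ρ p r := by
  have := eVariationOn.Icc_add_Icc ρ (s := Set.univ) hpq hqr (Set.mem_univ q)
  simpa [pathLengthOn] using this

theorem edist_le_pathLengthOn (ρ : Path x y) {p q : I} (hpq : p ≤ q) :
    edist (ρ p) (ρ q) ≤ pathLengthOn ρ p q :=
  eVariationOn.edist_le _ (Set.left_mem_Icc.2 hpq) (Set.right_mem_Icc.2 hpq)

theorem pathLengthOn_mono (ρ : Path x y) {p q p' q' : I} (hp : p' ≤ p) (hq : q ≤ q') :
    pathLengthOn ρ p q ≤ pathLengthOn ρ p' q' :=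
  eVariationOn.mono _ (Set.Icc_subset_Icc hp hq)

theorem pathLengthOn_le_of_lipschitz {K : NNReal} (ρ : Path x y) (h : LipschitzWith K ρ)
    {p q : I} (hpq : p ≤ q) : pathLengthOn ρ p q ≤ K * ENNReal.ofReal ((q : ℝ) - p) := by
  have h1 := (h.lipschitzOnWith (s := Set.univ)).comp_eVariationOn_le (g := (id : I → I))
    (s := Set.Icc p q) (Set.mapsTo_univ _ _)
  refine h1.trans ?_
  gcongr
  have h2 : eVariationOn (id : I → I) (Set.Icc p q) =
      eVariationOn (fun t : I => (t : ℝ)) (Set.Icc p q) := rfl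
  have hm : MonotoneOn (fun t : I => (t : ℝ)) (Set.Icc p q) := fun s _ t _ hst => hst
  have := hm.eVariationOn_eq (Set.left_mem_Icc.2 hpq) (Set.right_mem_Icc.2 hpq)
  rw [Set.inter_self] at this
  rw [h2, this]

theorem pathLengthOn_symm_le (μ : Path x y) : pathLengthOn μ.symm 0 1 ≤ pathLengthOn μ 0 1 :=
  eVariationOn.comp_le_of_antitoneOn μ unitInterval.symm
    (fun _ _ _ _ h => unitInterval.symm_le_symm.2 h)
    (fun _ _ => ⟨unitInterval.nonneg', unitInterval.le_one'⟩)

theorem pathLengthOn_trans_le (μ : Path x y) (ν : Path y z) :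
    pathLengthOn (μ.trans ν) 0 1 ≤ pathLengthOn μ 0 1 + pathLengthOn ν 0 1 := by
  let m : I := ⟨1 / 2, by norm_num, by norm_num⟩
  rw [← pathLengthOn_add (μ.trans ν) (q := m) unitInterval.nonneg' unitInterval.le_one']
  refine add_le_add ?_ ?_
  -- Each half of the concatenation is a monotone reparametrization; the clamping by `Set.projIcc`
  -- only makes it defined on all of `I`.
  · let φ : I → I := fun t => Set.projIcc 0 1 zero_le_one (2 * (t : ℝ))
    have : Set.EqOn (μ.trans ν) (μ ∘ φ) (Set.Icc 0 m) := by
      intro t ht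
      have ht' : (t : ℝ) ≤ 1 / 2 := ht.2
      have h0 := t.2.1
      rw [Path.trans_apply, dif_pos ht']
      simp only [Function.comp, φ]
      rw [Set.projIcc_of_mem zero_le_one (x := 2 * (t : ℝ)) ⟨by linarith, by linarith⟩]
    rw [pathLengthOn, eVariationOn.eq_of_eqOn this]
    refine eVariationOn.comp_le_of_monotoneOn μ φ (fun s _ t _ hst => ?_)
      (fun _ _ => ⟨unitInterval.nonneg', unitInterval.le_one'⟩)
    exact Set.monotone_projIcc zero_le_one (mul_le_mul_of_nonneg_left hst zero_le_two)
  · let φ : I → I := fun t => Set.projIcc 0 1 zero_le_one (2 * (t : ℝ) - 1)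
    have : Set.EqOn (μ.trans ν) (ν ∘ φ) (Set.Icc m 1) := by
      intro t ht
      have ht' : 1 / 2 ≤ (t : ℝ) := ht.1
      have h1 := t.2.2
      rw [Path.trans_apply]
      simp only [Function.comp, φ]
      rw [Set.projIcc_of_mem zero_le_one (x := 2 * (t : ℝ) - 1) ⟨by linarith, by linarith⟩]
      split_ifs with h
      · have e : (t : ℝ) = 1 / 2 := le_antisymm h ht'
        simp [e]
      · rfl
    rw [pathLengthOn, eVariationOn.eq_of_eqOn this]
    refine eVariationOn.comp_le_of_monotoneOn ν φ (fun s _ t _ hst => ?_)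
      (fun _ _ => ⟨unitInterval.nonneg', unitInterval.le_one'⟩)
    have hst' : (s : ℝ) ≤ t := hst
    exact Set.monotone_projIcc zero_le_one (by linarith)

theorem pathLengthOn_ne_top {ρ : Path x y} (h : pathLengthOn ρ 0 1 ≠ ∞) (p q : I) :
    pathLengthOn ρ p q ≠ ∞ :=
  ne_top_of_le_ne_top h (pathLengthOn_mono ρ unitInterval.nonneg' unitInterval.le_one')

theorem toReal_pathLengthOn_add {ρ : Path x y} (h : pathLengthOn ρ 0 1 ≠ ∞) {p q r : I}
    (hpq : p ≤ q) (hqr : q ≤ r) :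
    (pathLengthOn ρ p q).toReal + (pathLengthOn ρ q r).toReal = (pathLengthOn ρ p r).toReal := by
  rw [← pathLengthOn_add ρ hpq hqr,
    ENNReal.toReal_add (pathLengthOn_ne_top h _ _) (pathLengthOn_ne_top h _ _)]

theorem continuous_toReal_pathLengthOn {ρ : Path x y} (h : pathLengthOn ρ 0 1 ≠ ∞) :
    Continuous fun t : I => (pathLengthOn ρ 0 t).toReal := by
  rw [continuous_iff_continuousAt]
  intro t
  have hb : BoundedVariationOn ρ Set.univ := by
    have : (Set.univ : Set I) = Set.Icc 0 1 := by
      ext s; simp [unitInterval.le_one']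
    rw [this]
    exact h
  have h1 := hb.tendsto_eVariationOn_Icc_zero_left (x := t) ρ.continuous.continuousWithinAt
  have h2 := hb.tendsto_eVariationOn_Icc_zero_right t ρ.continuous.continuousWithinAt
  simp only [Set.univ_inter, nhdsWithin_univ] at h1 h2
  have h3 := ((ENNReal.tendsto_toReal ENNReal.zero_ne_top).comp h1).add
    ((ENNReal.tendsto_toReal ENNReal.zero_ne_top).comp h2)
  simp only [ENNReal.toReal_zero, add_zero] at h3
  rw [ContinuousAt, tendsto_iff_dist_tendsto_zero]
  refine squeeze_zero (fun _ => dist_nonneg) (fun s => ?_) h3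
  rw [Real.dist_eq]
  -- When `s` and `t` differ, one of the two lengths on the right is taken over an empty interval
  -- and is 0, so this bound serves both orders of `s` and `t`.
  change |(pathLengthOn ρ 0 s).toReal - (pathLengthOn ρ 0 t).toReal| ≤
    (pathLengthOn ρ s t).toReal + (pathLengthOn ρ t s).toReal
  have n1 : 0 ≤ (pathLengthOn ρ s t).toReal := ENNReal.toReal_nonneg
  have n2 : 0 ≤ (pathLengthOn ρ t s).toReal := ENNReal.toReal_nonneg
  rcases le_total s t with hst | hst
  · have := toReal_pathLengthOn_add h (unitInterval.nonneg' : 0 ≤ s) hst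
    rw [abs_le]
    constructor <;> linarith
  · have := toReal_pathLengthOn_add h (unitInterval.nonneg' : 0 ≤ t) hst
    rw [abs_le]
    constructor <;> linarith

theorem exists_toReal_pathLengthOn_eq {ρ : Path x y} (h : pathLengthOn ρ 0 1 ≠ ∞) {r : ℝ}
    (h0 : 0 ≤ r) (h1 : r ≤ (pathLengthOn ρ 0 1).toReal) :
    ∃ t : I, (pathLengthOn ρ 0 t).toReal = r := by
  refine mem_range_of_exists_le_of_exists_ge (continuous_toReal_pathLengthOn h) ⟨0, ?_⟩ ⟨1, h1⟩
  rw [pathLengthOn, Set.Icc_self, eVariationOn.subsingleton _ Set.subsingleton_singleton]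
  simpa using h0

end PathLength

/-! ### Paths in the metric space of a graph -/

namespace SimpleGraph

theorem dist_le_one_of_adj_or_eq {V : Type*} {Γ : SimpleGraph V} {u v : V} (h : Γ.Adj u v ∨ u = v) :
    Γ.dist u v ≤ 1 := by
  rcases h with h | h
  · exact (dist_eq_one_iff_adj.2 h).le
  · simp [h]

end SimpleGraph

namespace GraphSpace

variable {V : Type*} {Γ : SimpleGraph V} [Fact Γ.Connected]

/-- The point at distance `r` from `u` on the edge from `u` to `v`. -/
noncomputable def edgePoint {u v : V} (h : Γ.Adj u v ∨ u = v) (r : ℝ) (h0 : 0 ≤ r)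
    (h1 : r ≤ Γ.dist u v) : GraphSpace Γ :=
  SeparationQuotient.mk ⟨u, v, h, r, h0, h1⟩

theorem dist_vertex (u v : V) : dist (vertex Γ u) (vertex Γ v) = Γ.dist u v := by
  change EdgePoint.pathDist _ _ = _
  simp only [EdgePoint.pathDist, EdgePoint.outerDist, EdgePoint.copos]
  split_ifs with h
  · simp [h.1]
  · simp

theorem dist_edgePoint_same {u v : V} (h : Γ.Adj u v ∨ u = v) {r s : ℝ} (hr0 hr1 hs0 hs1) :
    dist (edgePoint h r hr0 hr1) (edgePoint h s hs0 hs1) = |r - s| := by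
  change EdgePoint.pathDist _ _ = _
  exact EdgePoint.pathDist_same rfl rfl

theorem edgePoint_zero {u v : V} (h : Γ.Adj u v ∨ u = v) {r : ℝ} (hr0 hr1) (hr : r = 0) :
    edgePoint h r hr0 hr1 = vertex Γ u := by
  rw [← dist_le_zero]
  change EdgePoint.pathDist _ _ ≤ _
  refine (EdgePoint.pathDist_le _ _).1.trans ?_
  simp [hr]

theorem edgePoint_dist {u v : V} (h : Γ.Adj u v ∨ u = v) {r : ℝ} (hr0 hr1)
    (hr : r = Γ.dist u v) : edgePoint h r hr0 hr1 = vertex Γ v := by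
  rw [← dist_le_zero]
  change EdgePoint.pathDist _ _ ≤ _
  refine (EdgePoint.pathDist_le _ _).2.2.1.trans ?_
  simp [hr, EdgePoint.copos]

theorem exists_path_vertex_edgePoint {u v : V} (h : Γ.Adj u v ∨ u = v) {r : ℝ} (hr0 hr1) :
    ∃ μ : Path (vertex Γ u) (edgePoint h r hr0 hr1), pathLengthOn μ 0 1 ≤ 1 := by
  have hb : ∀ s : I, (s : ℝ) * r ≤ Γ.dist u v := fun s =>
    (mul_le_of_le_one_left hr0 s.2.2).trans hr1
  let f : I → GraphSpace Γ := fun s => edgePoint h (s * r) (mul_nonneg s.2.1 hr0) (hb s)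
  have hr : r ≤ 1 := hr1.trans (by exact_mod_cast SimpleGraph.dist_le_one_of_adj_or_eq h)
  have hf : LipschitzWith 1 f := by
    refine LipschitzWith.of_dist_le_mul fun s t => ?_
    rw [dist_edgePoint_same, ← sub_mul, abs_mul, abs_of_nonneg hr0, Subtype.dist_eq, Real.dist_eq]
    have := abs_nonneg ((s : ℝ) - t)
    simp only [NNReal.coe_one]
    nlinarith
  let μ : Path (vertex Γ u) (edgePoint h r hr0 hr1) :=
    { toFun := f
      continuous_toFun := hf.continuous
      source' := edgePoint_zero h _ _ (by simp)
      target' := by simp [f] }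
  refine ⟨μ, ?_⟩
  have := pathLengthOn_le_of_lipschitz (K := 1) μ hf (p := 0) (q := 1) zero_le_one
  simpa using this

theorem exists_path_of_walk {u v : V} (w : Γ.Walk u v) :
    ∃ μ : Path (vertex Γ u) (vertex Γ v), pathLengthOn μ 0 1 ≤ w.length := by
  induction w with
  | nil =>
    refine ⟨Path.refl _, ?_⟩
    rw [pathLengthOn, eVariationOn.constant_on (by
      rintro _ ⟨s, _, rfl⟩ _ ⟨t, _, rfl⟩
      rfl)]
    simp
  | @cons u v' v hadj w ih =>
    obtain ⟨μ, hμ⟩ := ih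
    obtain ⟨ν, hν⟩ := exists_path_vertex_edgePoint (Or.inl hadj) (Nat.cast_nonneg _)
      (le_refl (Γ.dist u v' : ℝ))
    have e := edgePoint_dist (Or.inl hadj) (Nat.cast_nonneg _) (le_refl (Γ.dist u v' : ℝ)) rfl
    refine ⟨(ν.cast rfl e.symm).trans μ, (pathLengthOn_trans_le _ _).trans ?_⟩
    rw [SimpleGraph.Walk.length_cons, Nat.cast_add, Nat.cast_one, add_comm]
    exact add_le_add hμ hν

/-- Every point is at distance at most one from a vertex, and can be joined to it. -/
theorem exists_path_vertex (x : GraphSpace Γ) :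
    ∃ u : V, ∃ μ : Path (vertex Γ u) x, pathLengthOn μ 0 1 ≤ 1 := by
  obtain ⟨p, rfl⟩ := SeparationQuotient.surjective_mk x
  exact ⟨p.fst, exists_path_vertex_edgePoint p.adj_or_eq p.pos_nonneg p.pos_le⟩

/-- An approximation of points by vertices, such that distances between the vertices are bounded
below by distances of points, and points are joined by paths of length at most the distance between
the vertices, up to additive constants. -/
theorem exists_vertex_approximation (Γ : SimpleGraph V) [Fact Γ.Connected] :
    ∃ f : GraphSpace Γ → V,
      (∀ x y, (Γ.dist (f x) (f y) : ℝ) ≤ dist x y + 2) ∧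
      (∀ x y, ∃ μ : Path x y, pathLengthOn μ 0 1 ≤ ENNReal.ofReal (Γ.dist (f x) (f y) + 2)) := by
  choose f μ hμ using exists_path_vertex (Γ := Γ)
  have hd : ∀ x, dist (vertex Γ (f x)) x ≤ 1 := fun x => by
    have h := (edist_le_pathLengthOn (μ x) (p := 0) (q := 1) zero_le_one).trans (hμ x)
    rw [Path.source, Path.target, edist_dist, ENNReal.ofReal_le_one] at h
    exact h
  refine ⟨f, fun x y => ?_, fun x y => ?_⟩
  · rw [← dist_vertex]
    have h1 := dist_triangle4 (vertex Γ (f x)) x y (vertex Γ (f y))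
    have h2 := hd y
    rw [dist_comm] at h2
    linarith [hd x]
  · obtain ⟨w, hw⟩ := (Fact.out : Γ.Connected).exists_walk_length_eq_dist (f x) (f y)
    obtain ⟨ν, hν⟩ := exists_path_of_walk w
    refine ⟨((μ x).symm.trans ν).trans (μ y), (pathLengthOn_trans_le _ _).trans ?_⟩
    have e : ENNReal.ofReal ((Γ.dist (f x) (f y) : ℝ) + 2) = 1 + (Γ.dist (f x) (f y) : ℝ≥0∞) + 1 := by
      rw [ENNReal.ofReal_add (by positivity) (by norm_num), ENNReal.ofReal_natCast,
        ENNReal.ofReal_ofNat, add_comm 1, add_assoc, one_add_one_eq_two]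
    rw [e, ← hw]
    exact add_le_add ((pathLengthOn_trans_le _ _).trans
      (add_le_add ((pathLengthOn_symm_le _).trans (hμ x)) hν)) (hμ y)

end GraphSpace

/-! ### Isometric cycles in graphs -/

namespace GraphSpace

variable {V : Type*} {Γ : SimpleGraph V} [Fact Γ.Connected]

theorem edgePoint_congr {u v u' v' : V} {h : Γ.Adj u v ∨ u = v} {h' : Γ.Adj u' v' ∨ u' = v'}
    {r r' : ℝ} {h0 h1 h0' h1'} (hu : u = u') (hv : v = v') (hr : r = r') :
    edgePoint h r h0 h1 = edgePoint h' r' h0' h1' := by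
  subst hu hv hr
  rfl

theorem dist_vertex_edgePoint {u v : V} (h : Γ.Adj u v ∨ u = v) {r : ℝ} (h0 h1) :
    dist (vertex Γ u) (edgePoint h r h0 h1) = r := by
  rw [← edgePoint_zero h le_rfl (Nat.cast_nonneg _) rfl, dist_edgePoint_same, zero_sub, abs_neg,
    abs_of_nonneg h0]

theorem dist_edgePoint_vertex {u v : V} (h : Γ.Adj u v ∨ u = v) {r : ℝ} (h0 h1) :
    dist (edgePoint h r h0 h1) (vertex Γ v) = Γ.dist u v - r := by
  rw [← edgePoint_dist h (Nat.cast_nonneg _) le_rfl rfl, dist_edgePoint_same, abs_sub_comm,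
    abs_of_nonneg (sub_nonneg.2 h1)]

/-- The parametrization by arc length of a biinfinite edge path. -/
noncomputable def line (v : ℤ → V) (hv : ∀ i, Γ.Adj (v i) (v (i + 1))) (r : ℝ) : GraphSpace Γ :=
  edgePoint (Or.inl (hv ⌊r⌋)) (Int.fract r) (Int.fract_nonneg r) (by
    rw [SimpleGraph.dist_eq_one_iff_adj.2 (hv ⌊r⌋), Nat.cast_one]
    exact (Int.fract_lt_one r).le)

variable {v : ℤ → V} (hv : ∀ i, Γ.Adj (v i) (v (i + 1)))

theorem line_intCast (i : ℤ) : line v hv i = vertex Γ (v i) := by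
  rw [line, edgePoint_zero _ _ _ (Int.fract_intCast i), Int.floor_intCast]

theorem dist_le_of_adj (hv : ∀ i, Γ.Adj (v i) (v (i + 1))) (i : ℤ) (n : ℕ) : Γ.dist (v i) (v (i + n)) ≤ n := by
  induction n with
  | zero => simp
  | succ n ih =>
    have h1 := (Fact.out : Γ.Connected).dist_triangle (u := v i) (v := v (i + n))
      (w := v (i + n + 1))
    rw [SimpleGraph.dist_eq_one_iff_adj.2 (hv (i + n))] at h1
    push_cast
    rw [← add_assoc]
    omega

theorem dist_line_le_of_le {r s : ℝ} (hrs : r ≤ s) : dist (line v hv r) (line v hv s) ≤ s - r := by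
  have hr := Int.floor_add_fract r
  have hs := Int.floor_add_fract s
  rcases (Int.floor_mono hrs).eq_or_lt with hf | hf
  · have e : line v hv s = edgePoint (Or.inl (hv ⌊r⌋)) (Int.fract s) (Int.fract_nonneg s) (by
        rw [SimpleGraph.dist_eq_one_iff_adj.2 (hv ⌊r⌋), Nat.cast_one]
        exact (Int.fract_lt_one s).le) := edgePoint_congr (by rw [hf]) (by rw [hf]) rfl
    rw [e, line, dist_edgePoint_same, abs_sub_comm]
    rw [hf] at hr
    rw [abs_of_nonneg] <;> linarith
  · obtain ⟨n, hn⟩ := Int.le.dest hf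
    have h1 : dist (line v hv r) (vertex Γ (v (⌊r⌋ + 1))) = 1 - Int.fract r := by
      rw [line, dist_edgePoint_vertex, SimpleGraph.dist_eq_one_iff_adj.2 (hv ⌊r⌋), Nat.cast_one]
    have h2 : dist (vertex Γ (v ⌊s⌋)) (line v hv s) = Int.fract s := by
      rw [line, dist_vertex_edgePoint]
    have h3 : dist (vertex Γ (v (⌊r⌋ + 1))) (vertex Γ (v ⌊s⌋)) ≤ n := by
      rw [dist_vertex, ← hn]
      exact_mod_cast dist_le_of_adj hv (⌊r⌋ + 1) n
    have h4 : (⌊r⌋ : ℝ) + 1 + n = ⌊s⌋ := by exact_mod_cast hn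
    have h5 := dist_triangle4 (line v hv r) (vertex Γ (v (⌊r⌋ + 1))) (vertex Γ (v ⌊s⌋))
      (line v hv s)
    linarith

/-- A route through endpoints of the edges either joins opposite vertices, already at distance `h`,
or loses at most one in the vertex distance, which the offsets `Int.fract r` and `1 - Int.fract r`
restore. The bound `2 ≤ h` keeps the two edges distinct. -/
theorem le_dist_line_add {h : ℕ} (hh : 2 ≤ h) (hanti : ∀ i, h ≤ Γ.dist (v i) (v (i + h))) (r : ℝ) :
    h ≤ dist (line v hv r) (line v hv (r + h)) := by
  have hfl : ⌊r + h⌋ = ⌊r⌋ + h := Int.floor_add_natCast r h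
  have hfr : Int.fract (r + h) = Int.fract r := Int.fract_add_natCast r h
  have adj1 : ∀ i, Γ.dist (v i) (v (i + 1)) = 1 := fun i => SimpleGraph.dist_eq_one_iff_adj.2 (hv i)
  set i := ⌊r⌋ with hi
  have hΓ : Γ.Connected := Fact.out
  have hA := hanti i
  have hD := hanti (i + 1)
  rw [add_right_comm] at hD
  have hB : h ≤ Γ.dist (v i) (v (i + h + 1)) + 1 := by
    have := hΓ.dist_triangle (u := v i) (v := v (i + h + 1)) (w := v (i + h))
    rw [SimpleGraph.dist_comm (u := v (i + h + 1)), adj1] at this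
    omega
  have hC : h ≤ Γ.dist (v (i + 1)) (v (i + h)) + 1 := by
    have := hΓ.dist_triangle (u := v i) (v := v (i + 1)) (w := v (i + h))
    rw [adj1] at this
    omega
  have hA' : (h : ℝ) ≤ Γ.dist (v i) (v (i + h)) := by exact_mod_cast hA
  have hB' : (h : ℝ) ≤ Γ.dist (v i) (v (i + h + 1)) + 1 := by exact_mod_cast hB
  have hC' : (h : ℝ) ≤ Γ.dist (v (i + 1)) (v (i + h)) + 1 := by exact_mod_cast hC
  have hD' : (h : ℝ) ≤ Γ.dist (v (i + 1)) (v (i + h + 1)) := by exact_mod_cast hD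
  have f0 := Int.fract_nonneg r
  have f1 := Int.fract_lt_one r
  have e : line v hv (r + h) = edgePoint (Or.inl (hv (i + h))) (Int.fract r) (Int.fract_nonneg r)
      (by rw [adj1, Nat.cast_one]; exact f1.le) :=
    edgePoint_congr (by rw [hfl]) (by rw [hfl]) hfr
  rw [e, line]
  change _ ≤ EdgePoint.pathDist _ _
  rcases EdgePoint.pathDist_cases
    (⟨v i, v (i + 1), Or.inl (hv i), Int.fract r, f0, by rw [adj1, Nat.cast_one]; exact f1.le⟩ :
      EdgePoint Γ)
    ⟨v (i + h), v (i + h + 1), Or.inl (hv (i + h)), Int.fract r, f0,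
      by rw [adj1, Nat.cast_one]; exact f1.le⟩ with ⟨h1, _⟩ | ⟨h1, _⟩ | h1 | h1 | h1 | h1
  · dsimp only at h1
    rw [← h1, SimpleGraph.dist_self] at hA
    omega
  · dsimp only at h1
    rw [← h1, SimpleGraph.dist_self] at hB
    omega
  all_goals
    refine le_of_le_of_eq ?_ h1.symm
    simp only [EdgePoint.copos, adj1, Nat.cast_one]
    linarith

/-- A closed edge path of length `2 * h` in which any two opposite vertices are at distance `h` is
an isometrically embedded circle. -/
theorem exists_isometry_addCircle (hv : ∀ i, Γ.Adj (v i) (v (i + 1))) {h : ℕ} (hh : 2 ≤ h)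
    (hper : ∀ i, v (i + (2 * h : ℕ)) = v i)
    (hanti : ∀ i, h ≤ Γ.dist (v i) (v (i + h))) :
    ∃ γ : AddCircle ((2 * h : ℕ) : ℝ) → GraphSpace Γ, Isometry γ ∧
      ∀ i : ℤ, γ ((i : ℝ) : AddCircle ((2 * h : ℕ) : ℝ)) = vertex Γ (v i) := by
  set N : ℕ := 2 * h with hN
  have hp : Function.Periodic (line v hv) (N : ℝ) := fun r =>
    edgePoint_congr (by rw [Int.floor_add_natCast, hper])
      (by rw [Int.floor_add_natCast, add_right_comm, hper]) (Int.fract_add_natCast r N)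
  have key : ∀ r s : ℝ, r ≤ s → s ≤ r + h → dist (line v hv r) (line v hv s) = s - r := by
    intro r s hrs hs
    -- The point `s` lies on an arc of length `h` from `r` to its antipode. As the ends are at
    -- distance at least `h`, no part of this arc can be shortened.
    refine le_antisymm (dist_line_le_of_le hv hrs) ?_
    have h1 := le_dist_line_add hv hh hanti r
    have h2 := dist_line_le_of_le hv hs
    have h3 := dist_triangle (line v hv r) (line v hv s) (line v hv (r + h))
    linarith
  have key' : ∀ r s : ℝ, |r - s| ≤ h → dist (line v hv r) (line v hv s) = |r - s| := by
    intro r s hrs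
    rw [abs_le] at hrs
    rcases le_total r s with hle | hle
    · rw [key r s hle (by linarith), abs_sub_comm, abs_of_nonneg (sub_nonneg.2 hle)]
    · rw [dist_comm, key s r hle (by linarith), abs_of_nonneg (sub_nonneg.2 hle)]
  refine ⟨hp.lift, Isometry.of_dist_eq fun x y => ?_, fun i => ?_⟩
  · induction x using QuotientAddGroup.induction_on with
    | H r =>
      induction y using QuotientAddGroup.induction_on with
      | H s =>
        have hN0 : (N : ℝ) ≠ 0 := by
          have : N ≠ 0 := by omega
          exact_mod_cast this
        have hhalf := AddCircle.norm_le_half_period (N : ℝ) hN0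
          (x := ((r - s : ℝ) : AddCircle (N : ℝ)))
        rw [dist_eq_norm]
        change dist (line v hv r) (line v hv s) = ‖((r - s : ℝ) : AddCircle (N : ℝ))‖
        rw [AddCircle.norm_eq] at hhalf ⊢
        -- Shifting `s` by `k` periods brings it within half a period of `r`, where `key'` applies.
        set k := round ((N : ℝ)⁻¹ * (r - s))
        have e : line v hv s = line v hv (s + k * N) := by
          have := hp.int_mul k s
          exact this.symm
        have e' : r - s - k * N = r - (s + k * N) := by ring
        rw [e, e']
        apply key'
        have hNh : (N : ℝ) = 2 * h := by exact_mod_cast hN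
        rw [e', Nat.abs_cast] at hhalf
        linarith
  · exact (hp.lift_coe _).trans (line_intCast hv i)

end GraphSpace

/-! ### Isometric circles obstruct the strong shortcut property -/

theorem AddCircle.dist_coe_coe_eq_min {N : ℝ} (hN : 0 < N) {s : ℝ} (h0 : 0 ≤ s) (h1 : s ≤ N) (r : ℝ) :
    dist (r : AddCircle N) ((r + s : ℝ) : AddCircle N) = min s (N - s) := by
  have e : (r : AddCircle N) - ((r + s : ℝ) : AddCircle N) = -(s : AddCircle N) := by
    rw [AddCircle.coe_add]
    abel
  rw [dist_eq_norm, e, norm_neg]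
  rcases le_total s (N / 2) with h | h
  · rw [min_eq_left (by linarith), (AddCircle.norm_coe_eq_abs_iff N hN.ne').2, abs_of_nonneg h0]
    rwa [abs_of_nonneg h0, abs_of_pos hN]
  · have e' : (s : AddCircle N) = ((s - N : ℝ) : AddCircle N) := by
      rw [AddCircle.coe_sub, AddCircle.coe_period, sub_zero]
    rw [min_eq_right (by linarith), e', (AddCircle.norm_coe_eq_abs_iff N hN.ne').2,
      abs_of_nonpos (by linarith)]
    · ring
    · rw [abs_of_nonpos (by linarith), abs_of_pos hN]
      linarith

/-- A path between two points of an isometric circle is at least as long as the shorter arc, so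
together with the longer arc it has length at least that of the whole circle. -/
theorem not_stronglyShortcut_of_isometry_addCircle {X : Type*} [MetricSpace X]
    (h : ∀ L : ℝ, ∃ N : ℝ, L ≤ N ∧ 0 < N ∧ ∃ γ : AddCircle N → X, Isometry γ) :
    ¬ StronglyShortcut X := by
  rintro ⟨L, -, lam, hlam, H⟩
  obtain ⟨N, hLN, hN, γ, hγ⟩ := h L
  have hlip : LipschitzWith N.toNNReal fun t : I => γ ((t * N : ℝ) : AddCircle N) := by
    refine LipschitzWith.of_dist_le_mul fun s t => ?_
    rw [hγ.dist_eq, dist_eq_norm, ← AddCircle.coe_sub, Real.coe_toNNReal _ hN.le]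
    refine (QuotientAddGroup.norm_mk_le_norm).trans ?_
    rw [← sub_mul, norm_mul, Real.norm_of_nonneg hN.le, mul_comm]
    rfl
  let ρ : Path (γ (0 : AddCircle N)) (γ (0 : AddCircle N)) :=
    { toFun := fun t => γ ((t * N : ℝ) : AddCircle N)
      continuous_toFun := hlip.continuous
      source' := by simp
      target' := by simp [AddCircle.coe_period N] }
  have hup : ∀ {p q : I}, p ≤ q → pathLengthOn ρ p q ≤ ENNReal.ofReal (N * (q - p)) := by
    intro p q hpq
    rw [ENNReal.ofReal_mul hN.le]
    exact pathLengthOn_le_of_lipschitz ρ hlip hpq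
  have hdist : ∀ {p q : I}, p ≤ q →
      edist (ρ p) (ρ q) = ENNReal.ofReal (min (N * (q - p)) (N - N * (q - p))) := by
    intro p q hpq
    have hpq' : (p : ℝ) ≤ q := hpq
    have h0 := p.2.1
    have h1 := q.2.2
    rw [edist_dist]
    change ENNReal.ofReal (dist (γ ((p * N : ℝ) : AddCircle N)) (γ ((q * N : ℝ) : AddCircle N))) = _
    have e : (q * N : ℝ) = p * N + N * (q - p) := by ring
    rw [hγ.dist_eq, e, AddCircle.dist_coe_coe_eq_min hN (by nlinarith) (by nlinarith)]
  have hlow' : ∀ {p q : I}, p ≤ q → (q : ℝ) - p ≤ 1 / 2 →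
      ENNReal.ofReal (N * (q - p)) ≤ pathLengthOn ρ p q := by
    intro p q hpq hs
    refine le_trans ?_ (edist_le_pathLengthOn ρ hpq)
    rw [hdist hpq, min_eq_left (by nlinarith)]
  have hlow : ∀ {p q : I}, p ≤ q → ENNReal.ofReal (N * (q - p)) ≤ pathLengthOn ρ p q := by
    intro p q hpq
    have hpq' : (p : ℝ) ≤ q := hpq
    have h0 := p.2.1
    have h1 := q.2.2
    -- Arc length agrees with distance only up to half the circle, so the arc is bisected.
    let m : I := ⟨(p + q) / 2, by linarith [q.2.1], by linarith⟩
    have hpm : p ≤ m := by change (p : ℝ) ≤ (p + q) / 2; linarith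
    have hmq : m ≤ q := by change ((p : ℝ) + q) / 2 ≤ q; linarith
    rw [← pathLengthOn_add ρ hpm hmq]
    refine le_trans ?_ (add_le_add (hlow' hpm ?_) (hlow' hmq ?_))
    · rw [← ENNReal.ofReal_add]
      · apply ENNReal.ofReal_le_ofReal
        simp only [m]
        linarith
      · simp only [m]; nlinarith
      · simp only [m]; nlinarith
    · simp only [m]; linarith
    · simp only [m]; linarith
  have hlen : ∀ {p q : I}, p ≤ q → pathLengthOn ρ p q = ENNReal.ofReal (N * (q - p)) :=
    fun hpq => le_antisymm (hup hpq) (hlow hpq)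
  have htot : pathLengthOn ρ 0 1 = ENNReal.ofReal N := by
    rw [hlen zero_le_one]; simp
  obtain ⟨p, q, hpq, μ, h1, h2⟩ := H _ ρ (by rw [htot]; exact ENNReal.ofReal_ne_top)
    (by rw [htot]; exact ENNReal.ofReal_le_ofReal hLN)
  have hpq' : (p : ℝ) ≤ q := hpq
  have p0 := p.2.1
  have q1 := q.2.2
  have hμ := edist_le_pathLengthOn μ (zero_le_one : (0 : I) ≤ 1)
  rw [Path.source, Path.target, hdist hpq] at hμ
  have hlt : ENNReal.ofReal lam * ENNReal.ofReal N < ENNReal.ofReal N := by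
    rw [← ENNReal.ofReal_mul' hN.le, ENNReal.ofReal_lt_ofReal_iff hN]
    nlinarith
  rw [htot] at h1 h2
  rcases le_total (N * ((q : ℝ) - p)) (N - N * (q - p)) with hc | hc
  · rw [min_eq_left hc] at hμ
    refine (h2.trans_lt hlt).not_ge (le_trans ?_ (add_le_add_right hμ _))
    rw [hlen unitInterval.le_one', hlen unitInterval.nonneg', ← ENNReal.ofReal_add,
      ← ENNReal.ofReal_add]
    · apply ENNReal.ofReal_le_ofReal
      simp
      linarith
    all_goals (try simp); nlinarith
  · rw [min_eq_right hc] at hμ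
    refine (h1.trans_lt hlt).not_ge (le_trans ?_ (add_le_add_right hμ _))
    rw [hlen hpq, ← ENNReal.ofReal_add]
    · apply ENNReal.ofReal_le_ofReal
      linarith
    all_goals nlinarith

/-! ### Almost isometric octagons and the strong shortcut property -/

theorem GraphSpace.stronglyShortcut_of_octagon {V : Type*} (Γ : SimpleGraph V) [Fact Γ.Connected]
    {δ : ℝ} (hδ : 0 < δ)
    (H : ∀ (m : ℝ) (v : ℕ → V), 0 < m →
      (∀ i j : ℕ, i < j → j < 8 → (Γ.dist (v i) (v j) : ℝ) ≤ (j - i) * m + δ * m ∧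
        (Γ.dist (v i) (v j) : ℝ) ≤ (8 - (j - i)) * m + δ * m) →
      ∃ i j : ℕ, i < j ∧ j < 8 ∧ (Γ.dist (v i) (v j) : ℝ) + δ * m ≤ (j - i) * m ∧
        (Γ.dist (v i) (v j) : ℝ) + δ * m ≤ (8 - (j - i)) * m) :
    StronglyShortcut (GraphSpace Γ) := by
  -- With m = l/8, the choice of `L` gives 4 ≤ δm. The approximation errors 2 are then at most δm/2:
  -- a gain of δm between vertices leaves a gain of δm/2 = (δ/16)l for the loops.
  refine ⟨8 * (4 / δ), by positivity, 1 - δ / 16, by linarith, fun x ρ hρ hL => ?_⟩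
  obtain ⟨f, hf, hμ⟩ := exists_vertex_approximation Γ
  set l := (pathLengthOn ρ 0 1).toReal with hl
  have hl' : pathLengthOn ρ 0 1 = ENNReal.ofReal l := (ENNReal.ofReal_toReal hρ).symm
  have hLl : 8 * (4 / δ) ≤ l := by
    rw [hl', ENNReal.ofReal_le_ofReal_iff ENNReal.toReal_nonneg] at hL
    exact hL
  set m := l / 8 with hm
  have hlm : l = 8 * m := by rw [hm]; ring
  have hm1 : 4 ≤ δ * m := by
    have : 4 / δ ≤ m := by linarith
    rwa [div_le_iff₀' hδ] at this
  have hm0 : 0 < m := by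
    by_contra hneg
    nlinarith
  have ht : ∀ k : ℕ, ∃ t : I, k < 8 → (pathLengthOn ρ 0 t).toReal = k * m := by
    intro k
    by_cases hk : k < 8
    · have hk' : (k : ℝ) ≤ 8 := by exact_mod_cast hk.le
      obtain ⟨t, ht⟩ := exists_toReal_pathLengthOn_eq hρ (r := k * m) (by positivity)
        (by rw [← hl, hlm]; exact mul_le_mul_of_nonneg_right hk' hm0.le)
      exact ⟨t, fun _ => ht⟩
    · exact ⟨0, fun h => absurd h hk⟩
  choose t ht using ht
  have hmono : ∀ i j : ℕ, i < j → j < 8 → t i ≤ t j := by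
    intro i j hij hj
    by_contra hlt
    have h1 := ENNReal.toReal_mono (pathLengthOn_ne_top hρ _ _)
      (pathLengthOn_mono ρ (le_refl (0 : I)) (not_le.1 hlt).le)
    rw [ht i (hij.trans hj), ht j hj] at h1
    have h2 : (i : ℝ) < j := by exact_mod_cast hij
    nlinarith
  have hmid : ∀ i j : ℕ, i < j → j < 8 →
      pathLengthOn ρ (t i) (t j) = ENNReal.ofReal ((j - i) * m) := by
    intro i j hij hj
    have := toReal_pathLengthOn_add hρ (unitInterval.nonneg' : 0 ≤ t i) (hmono i j hij hj)
    rw [ht i (hij.trans hj), ht j hj] at this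
    rw [← ENNReal.ofReal_toReal (pathLengthOn_ne_top hρ (t i) (t j))]
    congr 1
    linarith
  have hleft : ∀ i : ℕ, i < 8 → pathLengthOn ρ 0 (t i) = ENNReal.ofReal (i * m) := by
    intro i hi
    rw [← ht i hi, ENNReal.ofReal_toReal (pathLengthOn_ne_top hρ _ _)]
  have hright : ∀ j : ℕ, j < 8 → pathLengthOn ρ (t j) 1 = ENNReal.ofReal ((8 - j) * m) := by
    intro j hj
    have := toReal_pathLengthOn_add hρ (unitInterval.nonneg' : 0 ≤ t j) unitInterval.le_one'
    rw [ht j hj, ← hl] at this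
    rw [← ENNReal.ofReal_toReal (pathLengthOn_ne_top hρ (t j) 1)]
    congr 1
    linarith
  have hup : ∀ i j : ℕ, i < j → j < 8 → dist (ρ (t i)) (ρ (t j)) ≤ (j - i) * m ∧
      dist (ρ (t i)) (ρ (t j)) ≤ (8 - (j - i)) * m := by
    intro i j hij hj
    have hij' : (i : ℝ) < j := by exact_mod_cast hij
    have hj' : (j : ℝ) < 8 := by exact_mod_cast hj
    have hi' : (0 : ℝ) ≤ i := Nat.cast_nonneg i
    constructor
    · have h1 := edist_le_pathLengthOn ρ (hmono i j hij hj)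
      rwa [hmid i j hij hj, edist_dist, ENNReal.ofReal_le_ofReal_iff (by nlinarith)] at h1
    · have h1 := edist_le_pathLengthOn ρ (unitInterval.nonneg' : 0 ≤ t i)
      have h2 := edist_le_pathLengthOn ρ (unitInterval.le_one' : t j ≤ 1)
      rw [hleft i (hij.trans hj), edist_dist, ENNReal.ofReal_le_ofReal_iff (by nlinarith),
        ρ.source] at h1
      rw [hright j hj, edist_dist, ENNReal.ofReal_le_ofReal_iff (by nlinarith), ρ.target] at h2
      have h3 := dist_triangle (ρ (t i)) x (ρ (t j))
      rw [dist_comm (ρ (t i)) x, dist_comm x (ρ (t j))] at h3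
      linarith
  obtain ⟨i, j, hij, hj, h1, h2⟩ := H m (fun k => f (ρ (t k))) hm0 (by
    intro i j hij hj
    have h1 := hf (ρ (t i)) (ρ (t j))
    have h2 := hup i j hij hj
    constructor <;> linarith)
  have hij' : (i : ℝ) < j := by exact_mod_cast hij
  have hj' : (j : ℝ) < 8 := by exact_mod_cast hj
  have hi' : (0 : ℝ) ≤ i := Nat.cast_nonneg i
  have hD : (0 : ℝ) ≤ Γ.dist (f (ρ (t i))) (f (ρ (t j))) := Nat.cast_nonneg _
  obtain ⟨μ, hμl⟩ := hμ (ρ (t i)) (ρ (t j))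
  refine ⟨t i, t j, hmono i j hij hj, μ, ?_, ?_⟩
  · refine (add_le_add_right hμl _).trans ?_
    rw [hmid i j hij hj, hl', ← ENNReal.ofReal_add (by nlinarith) (by linarith),
      ← ENNReal.ofReal_mul' ENNReal.toReal_nonneg]
    apply ENNReal.ofReal_le_ofReal
    rw [← hl, hlm]
    linarith
  · refine (add_le_add_right hμl _).trans ?_
    rw [hleft i (hij.trans hj), hright j hj, hl', ← ENNReal.ofReal_add (by nlinarith) (by nlinarith),
      ← ENNReal.ofReal_add (by nlinarith) (by linarith),
      ← ENNReal.ofReal_mul' ENNReal.toReal_nonneg]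
    apply ENNReal.ofReal_le_ofReal
    rw [← hl, hlm]
    linarith

/-! ### Almost isometric octagons in ℓ¹-products of trees -/

section FourPoint

variable {V : Type*} {d₁ d₂ : V → V → ℝ}

/-- If an `ℓ¹`-product has an almost isometric rectangle, then in a factor that satisfies the
four-point condition one of the sides of the rectangle is short. -/
theorem short_side_of_four_point (c₁ : ∀ x y, d₁ x y = d₁ y x) (c₂ : ∀ x y, d₂ x y = d₂ y x)
    (tri₂ : ∀ x y z, d₂ x z ≤ d₂ x y + d₂ y z)
    (four₁ : ∀ w x y z, d₁ x z + d₁ w y ≤ max (d₁ x y + d₁ w z) (d₁ y z + d₁ w x))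
    {s t s' t' : V} {A B ε : ℝ}
    (hs : A + B - ε ≤ d₁ s s' + d₂ s s') (ht : A + B - ε ≤ d₁ t t' + d₂ t t')
    (h1 : d₁ s t + d₂ s t ≤ A + ε) (h2 : d₁ t s' + d₂ t s' ≤ B + ε)
    (h3 : d₁ s' t' + d₂ s' t' ≤ A + ε) (h4 : d₁ s t' + d₂ s t' ≤ B + ε) :
    (d₁ s t ≤ 3 * ε ∧ d₁ s' t' ≤ 3 * ε) ∨ (d₁ t s' ≤ 3 * ε ∧ d₁ s t' ≤ 3 * ε) := by
  have a1 := tri₂ s t s'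
  have a3 := tri₂ t s' t'
  have a4 := tri₂ t s t'
  have a5 := tri₂ s t' s'
  rw [c₂ t s] at a4
  rw [c₂ t' s'] at a5
  -- One pair of opposite sides bounds the `d₁`-diagonals. The triangle inequality bounds the
  -- `d₂`-diagonals by the same pair plus twice either remaining side. Adding and comparing with the
  -- total lengths leaves twice the `d₁`-length of that remaining side at most 6ε.
  have f := four₁ t s t' s'
  rw [c₁ t s, c₁ t' s'] at f
  rcases le_max_iff.1 f with f | f
  · left; constructor <;> linarith
  · right; constructor <;> linarith

/-- The quadrilateral 0, 2, 4, 6 shows in which factor each side moves; the one turned by an eighth,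
1, 2, 5, 6, is incompatible with this because its corners 1 and 5 are inside sides. -/
theorem not_octagon_of_four_point (c₁ : ∀ x y, d₁ x y = d₁ y x) (c₂ : ∀ x y, d₂ x y = d₂ y x)
    (tri₁ : ∀ x y z, d₁ x z ≤ d₁ x y + d₁ y z) (tri₂ : ∀ x y z, d₂ x z ≤ d₂ x y + d₂ y z)
    (four₁ : ∀ w x y z, d₁ x z + d₁ w y ≤ max (d₁ x y + d₁ w z) (d₁ y z + d₁ w x))
    (four₂ : ∀ w x y z, d₂ x z + d₂ w y ≤ max (d₂ x y + d₂ w z) (d₂ y z + d₂ w x))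
    (nonneg₁ : ∀ x y, 0 ≤ d₁ x y) (nonneg₂ : ∀ x y, 0 ≤ d₂ x y)
    {m ε : ℝ} (hm : 0 < m) (hε : 50 * ε ≤ m) (v : ℕ → V)
    (hup : ∀ i j : ℕ, i < j → j < 8 → d₁ (v i) (v j) + d₂ (v i) (v j) ≤ (j - i) * m + ε ∧
      d₁ (v i) (v j) + d₂ (v i) (v j) ≤ (8 - (j - i)) * m + ε)
    (hlow : ∀ i j : ℕ, i < j → j < 8 → (j - i) * m - ε ≤ d₁ (v i) (v j) + d₂ (v i) (v j) ∨
      (8 - (j - i)) * m - ε ≤ d₁ (v i) (v j) + d₂ (v i) (v j)) : False := by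
  have low : ∀ i j : ℕ, i < j → j < 8 → j ≤ i + 4 →
      (j - i) * m - ε ≤ d₁ (v i) (v j) + d₂ (v i) (v j) := by
    intro i j hij hj hij4
    rcases hlow i j hij hj with h | h
    · exact h
    · have : (j : ℝ) ≤ i + 4 := by exact_mod_cast hij4
      nlinarith
  have side : ∀ i j : ℕ, i < j → j < i + 4 → j < 4 →
      ((d₁ (v i) (v j) ≤ 3 * ε ∧ d₁ (v (i + 4)) (v (j + 4)) ≤ 3 * ε) ∨
        (d₁ (v j) (v (i + 4)) ≤ 3 * ε ∧ d₁ (v i) (v (j + 4)) ≤ 3 * ε)) ∧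
      ((d₂ (v i) (v j) ≤ 3 * ε ∧ d₂ (v (i + 4)) (v (j + 4)) ≤ 3 * ε) ∨
        (d₂ (v j) (v (i + 4)) ≤ 3 * ε ∧ d₂ (v i) (v (j + 4)) ≤ 3 * ε)) := by
    intro i j hij hji hj
    have e1 := low i (i + 4) (by omega) (by omega) (by omega)
    have e2 := low j (j + 4) (by omega) (by omega) (by omega)
    have e3 := (hup i j hij (by omega)).1
    have e4 := (hup j (i + 4) hji (by omega)).1
    have e5 := (hup (i + 4) (j + 4) (by omega) (by omega)).1
    have e6 := (hup i (j + 4) (by omega) (by omega)).2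
    push_cast at e1 e2 e3 e4 e5 e6
    constructor
    · apply short_side_of_four_point c₁ c₂ tri₂ four₁ (A := (j - i) * m) (B := (4 - (j - i)) * m) <;>
        linarith
    · apply short_side_of_four_point c₂ c₁ tri₁ four₂ (A := (j - i) * m) (B := (4 - (j - i)) * m) <;>
        linarith
  -- Along an almost geodesic arc of the ℓ¹-sum each factor is almost geodesic too, since the
  -- triangle inequality in the other factor can only help.
  have mono : ∀ i j k : ℕ, i < j → j < k → k < 8 → k ≤ i + 4 →
      d₁ (v i) (v j) + d₁ (v j) (v k) ≤ d₁ (v i) (v k) + 3 * ε ∧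
      d₂ (v i) (v j) + d₂ (v j) (v k) ≤ d₂ (v i) (v k) + 3 * ε := by
    intro i j k hij hjk hk hik
    have e1 := low i k (by omega) hk hik
    have e2 := (hup i j hij (by omega)).1
    have e3 := (hup j k hjk hk).1
    have t1 := tri₁ (v i) (v j) (v k)
    have t2 := tri₂ (v i) (v j) (v k)
    constructor <;> linarith
  obtain ⟨p1, p2⟩ := side 0 2 (by norm_num) (by norm_num) (by norm_num)
  obtain ⟨q1, q2⟩ := side 1 2 (by norm_num) (by norm_num) (by norm_num)
  have m012 := mono 0 1 2 (by norm_num) (by norm_num) (by norm_num) (by norm_num)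
  have m245 := mono 2 4 5 (by norm_num) (by norm_num) (by norm_num) (by norm_num)
  have m456 := mono 4 5 6 (by norm_num) (by norm_num) (by norm_num) (by norm_num)
  have l02 := low 0 2 (by norm_num) (by norm_num) (by norm_num)
  have l24 := low 2 4 (by norm_num) (by norm_num) (by norm_num)
  have l01 := low 0 1 (by norm_num) (by norm_num) (by norm_num)
  have l12 := low 1 2 (by norm_num) (by norm_num) (by norm_num)
  have l45 := low 4 5 (by norm_num) (by norm_num) (by norm_num)
  have l56 := low 5 6 (by norm_num) (by norm_num) (by norm_num)
  norm_num at p1 p2 q1 q2 l02 l24 l01 l12 l45 l56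
  obtain ⟨m1, m2⟩ := m012
  obtain ⟨m3, m4⟩ := m245
  obtain ⟨m5, m6⟩ := m456
  have n1 := nonneg₁ (v 0) (v 1)
  have n2 := nonneg₂ (v 0) (v 1)
  have n3 := nonneg₁ (v 5) (v 6)
  have n4 := nonneg₂ (v 5) (v 6)
  have n5 := nonneg₁ (v 4) (v 5)
  have n6 := nonneg₂ (v 4) (v 5)
  have n7 := nonneg₁ (v 2) (v 4)
  have n8 := nonneg₂ (v 2) (v 4)
  -- If both factors collapse the same pair, side 02 or 24 is too short. Otherwise say 02 and 46
  -- collapse in `d₁` and 24 in `d₂`. If 12 collapses in `d₂`, it is short in both factors; if 25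
  -- does, then 45 is short in both.
  rcases p1 with ⟨p1, p1'⟩ | ⟨p1, p1'⟩ <;> rcases p2 with ⟨p2, p2'⟩ | ⟨p2, p2'⟩
  · linarith
  · rcases q2 with ⟨q2, q2'⟩ | ⟨q2, q2'⟩ <;> linarith
  · rcases q1 with ⟨q1, q1'⟩ | ⟨q1, q1'⟩ <;> linarith
  · linarith

end FourPoint

/-! ### The Cayley graph of a product of free groups with respect to the standard basis -/

theorem SimpleGraph.le_dist_of_adj {V : Type*} {Γ : SimpleGraph V} (hΓ : Γ.Connected)
    {f : V → V → ℕ} (hself : ∀ u, f u u = 0) (htri : ∀ u v w, f u w ≤ f u v + f v w)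
    (hadj : ∀ u v, Γ.Adj u v → f u v ≤ 1) (u v : V) : f u v ≤ Γ.dist u v := by
  obtain ⟨w, hw⟩ := hΓ.exists_walk_length_eq_dist u v
  rw [← hw]
  clear hw
  induction w with
  | nil => simp [hself]
  | @cons u v' v h w ih =>
    have h1 := htri u v' v
    have h2 := hadj u v' h
    rw [SimpleGraph.Walk.length_cons]
    omega

theorem SimpleGraph.dist_mulCayley_self_mul_le_one {G : Type*} [Group G] {S : Set G} (x : G) {s : G}
    (hs : s ∈ S) : (SimpleGraph.mulCayley S).dist x (x * s) ≤ 1 := by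
  refine SimpleGraph.dist_le_one_of_adj_or_eq ?_
  by_cases h : x = x * s
  · exact Or.inr h
  · exact Or.inl ((SimpleGraph.mulCayley_adj' S _ _).2 ⟨h, s, hs, Or.inl rfl⟩)

theorem SimpleGraph.dist_mulCayley_le_norm {G α : Type*} [Group G] [DecidableEq α] {S : Set G}
    (hS : (SimpleGraph.mulCayley S).Connected) (φ : FreeGroup α →* G)
    (hφ : ∀ i, φ (FreeGroup.of i) ∈ S) (x : G) (g : FreeGroup α) :
    (SimpleGraph.mulCayley S).dist x (x * φ g) ≤ g.norm := by
  have key : ∀ (l : List (α × Bool)) (x : G),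
      (SimpleGraph.mulCayley S).dist x (x * φ (FreeGroup.mk l)) ≤ l.length := by
    intro l
    induction l with
    | nil => intro x; simp [← FreeGroup.one_eq_mk]
    | cons a l ih =>
      intro x
      have e : FreeGroup.mk (a :: l) = FreeGroup.mk [a] * FreeGroup.mk l := by
        simp [FreeGroup.mul_mk]
      have h1 : (SimpleGraph.mulCayley S).dist x (x * φ (FreeGroup.mk [a])) ≤ 1 := by
        obtain ⟨i, b⟩ := a
        cases b
        · have e' : FreeGroup.mk [(i, false)] = (FreeGroup.of i)⁻¹ := rfl
          rw [e', map_inv, SimpleGraph.dist_comm]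
          have := dist_mulCayley_self_mul_le_one (x * (φ (FreeGroup.of i))⁻¹) (hφ i)
          rwa [inv_mul_cancel_right] at this
        · exact dist_mulCayley_self_mul_le_one x (hφ i)
      have h2 := ih (x * φ (FreeGroup.mk [a]))
      have h3 := hS.dist_triangle (u := x) (v := x * φ (FreeGroup.mk [a]))
        (w := x * φ (FreeGroup.mk [a]) * φ (FreeGroup.mk l))
      rw [e, map_mul, ← mul_assoc, List.length_cons]
      omega
  have := key g.toWord x
  rwa [FreeGroup.mk_toWord] at this

namespace FreeProd

/-- The upper bound moves one coordinate at a time, through `(y.1, x.2)`; the lower bound holds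
because every edge changes the ℓ¹-sum by one. -/
theorem dist_mulCayley_abcd (x y : FreeProd) :
    (SimpleGraph.mulCayley ({a, b, c, d} : Set FreeProd)).dist x y =
      FreeGroup.wordDist x.1 y.1 + FreeGroup.wordDist x.2 y.2 := by
  have hS := mulCayley_connected closure_abcd
  apply le_antisymm
  · have h1 := SimpleGraph.dist_mulCayley_le_norm hS
      (MonoidHom.inl (FreeGroup (Fin 2)) (FreeGroup (Fin 2)))
      (fun i => by fin_cases i <;> simp [a, b, c, d]) x (x.1⁻¹ * y.1)
    have h2 := SimpleGraph.dist_mulCayley_le_norm hS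
      (MonoidHom.inr (FreeGroup (Fin 2)) (FreeGroup (Fin 2)))
      (fun i => by fin_cases i <;> simp [a, b, c, d]) (y.1, x.2) (x.2⁻¹ * y.2)
    have e1 : x * MonoidHom.inl (FreeGroup (Fin 2)) (FreeGroup (Fin 2)) (x.1⁻¹ * y.1) =
        (y.1, x.2) := by ext <;> simp
    have e2 : ((y.1, x.2) : FreeProd) *
        MonoidHom.inr (FreeGroup (Fin 2)) (FreeGroup (Fin 2)) (x.2⁻¹ * y.2) = y := by ext <;> simp
    rw [e1] at h1
    rw [e2] at h2
    exact hS.dist_triangle.trans (add_le_add h1 h2)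
  · refine SimpleGraph.le_dist_of_adj hS
      (f := fun x y : FreeProd => FreeGroup.wordDist x.1 y.1 + FreeGroup.wordDist x.2 y.2)
      (fun u => by simp [FreeGroup.wordDist_self]) (fun u v w => ?_) (fun u v h => ?_) x y
    · have h1 := FreeGroup.wordDist_triangle u.1 v.1 w.1
      have h2 := FreeGroup.wordDist_triangle u.2 v.2 w.2
      omega
    · have hs : ∀ u : FreeProd, ∀ s ∈ ({a, b, c, d} : Set FreeProd),
          FreeGroup.wordDist u.1 (u * s).1 + FreeGroup.wordDist u.2 (u * s).2 = 1 := by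
        rintro u s (rfl | rfl | rfl | rfl) <;>
          simp [a, b, c, d, FreeGroup.wordDist_self_mul, FreeGroup.wordDist_self]
      obtain ⟨-, s, hsS, rfl | rfl⟩ := (SimpleGraph.mulCayley_adj' _ _ _).1 h
      · exact (hs u s hsS).le
      · have := hs v s hsS
        rw [FreeGroup.wordDist_comm, FreeGroup.wordDist_comm v.2] at this
        exact this.le

theorem stronglyShortcut_abcd :
    StronglyShortcut (GraphSpace (SimpleGraph.mulCayley ({a, b, c, d} : Set FreeProd))) := by
  refine GraphSpace.stronglyShortcut_of_octagon _ (δ := 1 / 50) (by norm_num) fun m v hm hup => ?_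
  by_contra! H
  simp only [dist_mulCayley_abcd, Nat.cast_add] at hup H
  refine not_octagon_of_four_point
    (d₁ := fun x y : FreeProd => (FreeGroup.wordDist x.1 y.1 : ℝ))
    (d₂ := fun x y : FreeProd => (FreeGroup.wordDist x.2 y.2 : ℝ))
    (fun x y => by rw [FreeGroup.wordDist_comm]) (fun x y => by rw [FreeGroup.wordDist_comm])
    (fun x y z => by exact_mod_cast FreeGroup.wordDist_triangle x.1 y.1 z.1)
    (fun x y z => by exact_mod_cast FreeGroup.wordDist_triangle x.2 y.2 z.2)
    (fun w x y z => by exact_mod_cast FreeGroup.wordDist_four_point w.1 x.1 y.1 z.1)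
    (fun w x y z => by exact_mod_cast FreeGroup.wordDist_four_point w.2 x.2 y.2 z.2)
    (fun x y => Nat.cast_nonneg _) (fun x y => Nat.cast_nonneg _)
    hm (ε := 1 / 50 * m) (by linarith) v hup (fun i j hij hj => ?_)
  by_cases h : (FreeGroup.wordDist (v i).1 (v j).1 : ℝ) + FreeGroup.wordDist (v i).2 (v j).2 +
      1 / 50 * m ≤ (j - i) * m
  · right
    linarith [H i j hij hj h]
  · left
    linarith

end FreeProd

/-! ### Distances in the Cayley graph with respect to `a`, `b`, `c`, `d * b⁻¹` -/

/-- The edge is the one by which a geodesic first enters `S`; the inequality keeps the geodesic's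
two remaining pieces. -/
theorem SimpleGraph.Connected.exists_adj_crossing {V : Type*} {Γ : SimpleGraph V}
    (hΓ : Γ.Connected) {S : Set V} {u v : V} (hu : u ∉ S) (hv : v ∈ S) :
    ∃ x y, Γ.Adj x y ∧ x ∉ S ∧ y ∈ S ∧ Γ.dist u x + 1 + Γ.dist y v ≤ Γ.dist u v := by
  obtain ⟨w, hw⟩ := hΓ.exists_walk_length_eq_dist u v
  rw [← hw]
  clear hw
  induction w with
  | nil => exact absurd hv hu
  | @cons u v' v h w ih =>
    by_cases hv' : v' ∈ S
    · refine ⟨u, v', h, hu, hv', ?_⟩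
      have := SimpleGraph.dist_le w
      rw [SimpleGraph.dist_self, SimpleGraph.Walk.length_cons]
      omega
    · obtain ⟨x, y, hxy, hx, hy, hle⟩ := ih hv' hv
      refine ⟨x, y, hxy, hx, hy, ?_⟩
      have h1 := hΓ.dist_triangle (u := u) (v := v') (w := x)
      rw [SimpleGraph.dist_eq_one_iff_adj.2 h] at h1
      rw [SimpleGraph.Walk.length_cons]
      omega

theorem Int.abs_add_abs_le_iff {p q n : ℤ} :
    |p| + |q| ≤ n ↔ p + q ≤ n ∧ p - q ≤ n ∧ -p + q ≤ n ∧ -p - q ≤ n := by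
  rcases abs_cases p with ⟨h, _⟩ | ⟨h, _⟩ <;> rcases abs_cases q with ⟨h', _⟩ | ⟨h', _⟩ <;> omega

/-! ### Half-trees and exponent sums in the free group -/

namespace FreeGroup

/-- The weights ±1 are chosen to agree in sign with the exponents, so that every letter contributes
+1. -/
theorem succ_le_norm_conj_halves {z : FreeGroup (Fin 2)} (hz : z = of 0 ∨ z = (of 0)⁻¹) (i : ℕ) :
    i + 1 ≤ norm (of 1 ^ i * z) ∧ i + 1 ≤ norm (z * (of 1 ^ i)⁻¹) := by
  have hv : ∀ e f : ℤ, |e| ≤ 1 → |f| ≤ 1 → ∀ j : Fin 2, |(![e, f] : Fin 2 → ℤ) j| ≤ 1 := by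
    intro e f he hf j
    fin_cases j <;> simpa
  have key : ∀ (e f : ℤ) (x : FreeGroup (Fin 2)), |e| ≤ 1 → |f| ≤ 1 →
      (weight ![e, f] x).toAdd ≤ norm x := fun e f x he hf =>
    (le_abs_self _).trans (abs_weight_le _ (hv e f he hf) x)
  rcases hz with rfl | rfl
  · have h1 := key 1 1 (of 1 ^ i * of 0) (by simp) (by simp)
    have h2 := key 1 (-1) (of 0 * (of 1 ^ i)⁻¹) (by simp) (by simp)
    simp at h1 h2
    omega
  · have h1 := key (-1) 1 (of 1 ^ i * (of 0)⁻¹) (by simp) (by simp)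
    have h2 := key (-1) (-1) ((of 0)⁻¹ * (of 1 ^ i)⁻¹) (by simp) (by simp)
    simp at h1 h2
    omega

/-- The half-tree that separates `u` from `u * (of 1 ^ i * z * (of 1 ^ i)⁻¹)` at the edge from
`u * of 1 ^ i` to `u * of 1 ^ i * z`. -/
theorem exists_halfTree {z : FreeGroup (Fin 2)} (hz : z = of 0 ∨ z = (of 0)⁻¹) (i : ℕ)
    (u : FreeGroup (Fin 2)) :
    ∃ S : Set (FreeGroup (Fin 2)), u ∉ S ∧ u * (of 1 ^ i * z * (of 1 ^ i)⁻¹) ∈ S ∧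
      ∀ x y, x ∉ S → y ∈ S → wordDist x y = 1 →
        (weight ![0, 1] x).toAdd = (weight ![0, 1] u).toAdd + i ∧
        (weight ![0, 1] y).toAdd = (weight ![0, 1] u).toAdd + i ∧
        (weight ![1, 0] x).toAdd ≠ (weight ![1, 0] y).toAdd := by
  obtain ⟨n1, n2⟩ := succ_le_norm_conj_halves hz i
  have hz1 : norm z = 1 := by rcases hz with rfl | rfl <;> simp
  -- The half-tree consists of the points closer to the far end of the edge than to the near end.
  refine ⟨{y | wordDist (u * of 1 ^ i * z) y < wordDist (u * of 1 ^ i) y}, ?_, ?_, ?_⟩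
  · have e1 := wordDist_self_mul u (of 1 ^ i)
    have e2 := wordDist_self_mul u (of 1 ^ i * z)
    rw [Set.mem_ofPred_eq, wordDist_comm _ u, wordDist_comm _ u, e1, mul_assoc, e2, norm_of_pow]
    omega
  · have e1 := wordDist_self_mul (u * of 1 ^ i * z) (of 1 ^ i)⁻¹
    have e2 := wordDist_self_mul (u * of 1 ^ i) (z * (of 1 ^ i)⁻¹)
    have e : u * (of 1 ^ i * z * (of 1 ^ i)⁻¹) = u * of 1 ^ i * z * (of 1 ^ i)⁻¹ := by
      simp only [mul_assoc]
    rw [Set.mem_ofPred_eq, e, e1, mul_assoc _ z, e2, norm_inv_eq, norm_of_pow]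
    omega
  · intro x y hx hy hxy
    simp only [Set.mem_ofPred_eq, not_lt] at hx hy
    obtain ⟨rfl, rfl⟩ := eq_of_wordDist_crossing
      (by rw [wordDist_self_mul, hz1]) hxy hx hy
    rcases hz with rfl | rfl <;> simp

end FreeGroup

namespace FreeProd

open FreeGroup

/-- Here `![1, 0]` and `![0, 1]` give the exponent sums of `of 0` and `of 1`. The third and fourth
clauses say that `a` and `c` move one coordinate alone; the last is the potential that `b` and `t`
change by one and `a` and `c` leave fixed. -/
theorem adj_cases {x y : FreeProd}
    (h : (SimpleGraph.mulCayley ({a, b, c, d * b⁻¹} : Set FreeProd)).Adj x y) :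
    (x.1 = y.1 ∨ wordDist x.1 y.1 = 1) ∧ (x.2 = y.2 ∨ wordDist x.2 y.2 = 1) ∧
    ((weight ![1, 0] x.1).toAdd ≠ (weight ![1, 0] y.1).toAdd → x.2 = y.2) ∧
    ((weight ![1, 0] x.2).toAdd ≠ (weight ![1, 0] y.2).toAdd → x.1 = y.1) ∧
    |(weight ![0, 1] y.1).toAdd + (weight ![0, 1] y.2).toAdd -
      ((weight ![0, 1] x.1).toAdd + (weight ![0, 1] x.2).toAdd)| +
      |(weight ![0, 1] y.2).toAdd - (weight ![0, 1] x.2).toAdd| ≤ 1 := by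
  have key : ∀ u : FreeProd, ∀ s ∈ ({a, b, c, d * b⁻¹} : Set FreeProd),
      (u.1 = (u * s).1 ∨ wordDist u.1 (u * s).1 = 1) ∧
      (u.2 = (u * s).2 ∨ wordDist u.2 (u * s).2 = 1) ∧
      ((weight ![1, 0] u.1).toAdd ≠ (weight ![1, 0] (u * s).1).toAdd → u.2 = (u * s).2) ∧
      ((weight ![1, 0] u.2).toAdd ≠ (weight ![1, 0] (u * s).2).toAdd → u.1 = (u * s).1) ∧
      |(weight ![0, 1] (u * s).1).toAdd + (weight ![0, 1] (u * s).2).toAdd -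
        ((weight ![0, 1] u.1).toAdd + (weight ![0, 1] u.2).toAdd)| +
        |(weight ![0, 1] (u * s).2).toAdd - (weight ![0, 1] u.2).toAdd| ≤ 1 := by
    rintro u s (rfl | rfl | rfl | rfl) <;> simp [a, b, c, d, wordDist_self_mul]
    ring
  obtain ⟨-, s, hs, rfl | rfl⟩ := (SimpleGraph.mulCayley_adj' _ _ _).1 h
  · exact key x s hs
  · obtain ⟨h1, h2, h3, h4, h5⟩ := key y s hs
    refine ⟨?_, ?_, fun h => (h3 h.symm).symm, fun h => (h4 h.symm).symm, ?_⟩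
    · rwa [eq_comm, wordDist_comm]
    · rwa [eq_comm, wordDist_comm]
    · rwa [abs_sub_comm, abs_sub_comm (weight ![0, 1] y.2).toAdd]

theorem abs_weight_sub_add_le_dist (x y : FreeProd) :
    |(weight ![0, 1] y.1).toAdd + (weight ![0, 1] y.2).toAdd -
      ((weight ![0, 1] x.1).toAdd + (weight ![0, 1] x.2).toAdd)| +
      |(weight ![0, 1] y.2).toAdd - (weight ![0, 1] x.2).toAdd| ≤
    (SimpleGraph.mulCayley ({a, b, c, d * b⁻¹} : Set FreeProd)).dist x y := by
  have := SimpleGraph.le_dist_of_adj (mulCayley_connected closure_abct)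
    (f := fun x y : FreeProd =>
      (|(weight ![0, 1] y.1).toAdd + (weight ![0, 1] y.2).toAdd -
      ((weight ![0, 1] x.1).toAdd + (weight ![0, 1] x.2).toAdd)| +
      |(weight ![0, 1] y.2).toAdd - (weight ![0, 1] x.2).toAdd|).toNat)
    (fun u => by simp) (fun u v w => by
      have h1 := abs_sub_le
        ((weight ![0, 1] w.1).toAdd + (weight ![0, 1] w.2).toAdd)
        ((weight ![0, 1] v.1).toAdd + (weight ![0, 1] v.2).toAdd)
        ((weight ![0, 1] u.1).toAdd + (weight ![0, 1] u.2).toAdd)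
      have h2 := abs_sub_le (weight ![0, 1] w.2).toAdd (weight ![0, 1] v.2).toAdd
        (weight ![0, 1] u.2).toAdd
      omega)
    (fun u v h => by
      have := (adj_cases h).2.2.2.2
      omega) x y
  omega

theorem le_dist_self_mul (u : FreeProd) (i k : ℕ) {z : FreeGroup (Fin 2)}
    (hz : z = of 0 ∨ z = (of 0)⁻¹) :
    2 * (i + k) + 2 ≤ (SimpleGraph.mulCayley ({a, b, c, d * b⁻¹} : Set FreeProd)).dist u
      (u * (of 1 ^ i * of 0 * (of 1 ^ i)⁻¹, of 1 ^ k * z * (of 1 ^ k)⁻¹)) := by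
  set v : FreeProd := u * (of 1 ^ i * of 0 * (of 1 ^ i)⁻¹, of 1 ^ k * z * (of 1 ^ k)⁻¹) with hv
  have hconn := mulCayley_connected closure_abct
  set Γ := SimpleGraph.mulCayley ({a, b, c, d * b⁻¹} : Set FreeProd) with hΓ
  obtain ⟨S, uS, vS, hS⟩ := exists_halfTree (z := of 0) (Or.inl rfl) i u.1
  obtain ⟨T, uT, vT, hT⟩ := exists_halfTree hz k u.2
  have crossS : ∀ x y, x.1 ∉ S → y.1 ∈ S → ∃ x' y' : FreeProd, x'.2 = y'.2 ∧
      (weight ![0, 1] x'.1).toAdd = (weight ![0, 1] u.1).toAdd + i ∧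
      (weight ![0, 1] y'.1).toAdd = (weight ![0, 1] u.1).toAdd + i ∧
      Γ.dist x x' + 1 + Γ.dist y' y ≤ Γ.dist x y := by
    intro x y hx hy
    obtain ⟨x', y', hadj, hx', hy', hd⟩ := hconn.exists_adj_crossing (S := Prod.fst ⁻¹' S)
      (u := x) (v := y) hx hy
    obtain ⟨h1, -, h3, -, -⟩ := adj_cases hadj
    have hne : x'.1 ≠ y'.1 := fun h => hx' (by rw [Set.mem_preimage, h]; exact hy')
    obtain ⟨e1, e2, e3⟩ := hS x'.1 y'.1 hx' hy' (h1.resolve_left hne)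
    exact ⟨x', y', h3 e3, e1, e2, hd⟩
  obtain ⟨x, y, hadj, hx, hy, hd⟩ := hconn.exists_adj_crossing (S := Prod.snd ⁻¹' T)
    (u := u) (v := v) uT vT
  obtain ⟨-, h2, -, h4, -⟩ := adj_cases hadj
  have hne : x.2 ≠ y.2 := fun h => hx (by rw [Set.mem_preimage, h]; exact hy)
  obtain ⟨e1, e2, e3⟩ := hT x.2 y.2 hx hy (h2.resolve_left hne)
  have e4 := h4 e3
  have v1 : (weight ![0, 1] v.1).toAdd = (weight ![0, 1] u.1).toAdd := by simp [hv]
  have v2 : (weight ![0, 1] v.2).toAdd = (weight ![0, 1] u.2).toAdd := by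
    rcases hz with rfl | rfl <;> simp [hv]
  have e5 : (weight ![0, 1] x.1).toAdd = (weight ![0, 1] y.1).toAdd := by rw [e4]
  -- The case distinction is whether the geodesic enters `S` before or after it enters `T`. If q is
  -- the relative value of δ at the crossing into `S`, the δ-part of the tour costs at least 2k + 2
  -- max(0, -q) and the (β + δ)-part at least 2|i + q|, in either order.
  by_cases hxS : x.1 ∈ S
  · obtain ⟨x', y', f1, f2, f3, f4⟩ := crossS u x uS hxS
    have f5 : (weight ![0, 1] x'.2).toAdd = (weight ![0, 1] y'.2).toAdd := by rw [f1]
    have c1 := abs_weight_sub_add_le_dist u x'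
    have c2 := abs_weight_sub_add_le_dist y' x
    have c3 := abs_weight_sub_add_le_dist y v
    rw [← hΓ, Int.abs_add_abs_le_iff] at c1 c2 c3
    omega
  · obtain ⟨x', y', f1, f2, f3, f4⟩ := crossS y v (e4 ▸ hxS) vS
    have f5 : (weight ![0, 1] x'.2).toAdd = (weight ![0, 1] y'.2).toAdd := by rw [f1]
    have c1 := abs_weight_sub_add_le_dist u x
    have c2 := abs_weight_sub_add_le_dist y x'
    have c3 := abs_weight_sub_add_le_dist y' v
    rw [← hΓ, Int.abs_add_abs_le_iff] at c1 c2 c3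
    omega

end FreeProd

/-! ### Words that define isometric cycles -/

theorem List.take_eq_of_eq_append {α : Type*} {l l₁ l₂ : List α} {n : ℕ} (h : l = l₁ ++ l₂)
    (hn : l₁.length = n) : l.take n = l₁ := by
  rw [h, List.take_left' hn]

theorem definesIsometricCycle_of_le_dist {G : Type*} [Group G] {S : Set G}
    [Fact (SimpleGraph.mulCayley S).Connected] {w : List G} {h : ℕ} (hh : 2 ≤ h)
    (hlen : w.length = 2 * h) (hprod : w.prod = 1) (hS : ∀ s ∈ w, s ≠ 1 ∧ (s ∈ S ∨ s⁻¹ ∈ S))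
    (hdist : ∀ j < h, h ≤ (SimpleGraph.mulCayley S).dist (w.take j).prod (w.take (j + h)).prod) :
    DefinesIsometricCycle (SimpleGraph.mulCayley S) w := by
  have hadj : ∀ j < 2 * h,
      (SimpleGraph.mulCayley S).Adj (w.take j).prod (w.take (j + 1)).prod := by
    intro j hj
    have hj' : j < w.length := by omega
    obtain ⟨h1, h2⟩ := hS w[j] (List.getElem_mem hj')
    rw [List.prod_take_succ w j hj', SimpleGraph.mulCayley_adj']
    refine ⟨by simpa using h1, ?_⟩
    rcases h2 with h2 | h2
    · exact ⟨_, h2, Or.inl rfl⟩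
    · exact ⟨_, h2, Or.inr (by simp)⟩
  have hlast : (w.take (2 * h)).prod = 1 := by rw [← hlen, List.take_length, hprod]
  have hv : ∀ i : ℤ, (SimpleGraph.mulCayley S).Adj
      (w.take (i % (2 * h : ℕ)).toNat).prod (w.take ((i + 1) % (2 * h : ℕ)).toNat).prod := by
    intro i
    have h0 := Int.emod_nonneg i (b := ((2 * h : ℕ) : ℤ)) (by omega)
    have h1 := Int.emod_lt_of_pos i (b := ((2 * h : ℕ) : ℤ)) (by omega)
    have e := hadj (i % (2 * h : ℕ)).toNat (by omega)
    rw [← Int.emod_add_emod]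
    -- The last edge closes up because the full product is 1.
    by_cases hc : i % (2 * h : ℕ) + 1 = (2 * h : ℕ)
    · rw [hc, Int.emod_self]
      have : (i % (2 * h : ℕ)).toNat + 1 = 2 * h := by omega
      rw [this, hlast] at e
      simpa using e
    · rw [Int.emod_eq_of_lt (a := i % (2 * h : ℕ) + 1) (by omega) (by omega)]
      have : (i % (2 * h : ℕ) + 1).toNat = (i % (2 * h : ℕ)).toNat + 1 := by omega
      rwa [this]
  obtain ⟨γ, hγ, hγv⟩ := GraphSpace.exists_isometry_addCircle
    (v := fun i : ℤ => (w.take (i % (2 * h : ℕ)).toNat).prod) hv hh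
    (fun i => by simp only [Int.add_emod_right]) (fun i => by
      have h0 := Int.emod_nonneg i (b := ((2 * h : ℕ) : ℤ)) (by omega)
      have h1 := Int.emod_lt_of_pos i (b := ((2 * h : ℕ) : ℤ)) (by omega)
      rw [← Int.emod_add_emod i]
      by_cases hc : i % (2 * h : ℕ) < h
      · rw [Int.emod_eq_of_lt (a := i % (2 * h : ℕ) + h) (by omega) (by omega)]
        have e := hdist (i % (2 * h : ℕ)).toNat (by omega)
        have : (i % (2 * h : ℕ) + h).toNat = (i % (2 * h : ℕ)).toNat + h := by omega
        rwa [this]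
      -- In the second half of the cycle the opposite pair is one from the first half, reversed.
      · have e := hdist (i % (2 * h : ℕ) - h).toNat (by omega)
        have e1 : (i % (2 * h : ℕ) + h) % (2 * h : ℕ) = i % (2 * h : ℕ) - h := by
          have : i % (2 * h : ℕ) + h = i % (2 * h : ℕ) - h + (2 * h : ℕ) := by omega
          rw [this, Int.add_emod_right, Int.emod_eq_of_lt (by omega) (by omega)]
        have e2 : (i % (2 * h : ℕ) - h).toNat + h = (i % (2 * h : ℕ)).toNat := by omega
        rw [e1, SimpleGraph.dist_comm]
        rwa [e2] at e)
  refine ⟨hprod, ?_⟩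
  rw [hlen]
  refine ⟨γ, hγ, fun i hi => ?_⟩
  have := hγv i
  rw [Int.cast_natCast] at this
  rw [this]
  rcases hi.eq_or_lt with rfl | hi
  · rw [hlast, Int.emod_self]
    simp
  · have e : ((i : ℤ) % (2 * h : ℕ)).toNat = i := by
      rw [Int.emod_eq_of_lt (by omega) (by omega), Int.toNat_natCast]
    rw [e]

namespace FreeProd

open FreeGroup

theorem length_word (n : ℕ) : (word n).length = 4 * n + 4 := by
  simp [word]
  omega

theorem prod_word (n : ℕ) : (word n).prod = 1 := by
  ext <;> simp [word, t, a, b, c, d]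

theorem mem_word_cases {n : ℕ} {s : FreeProd} (hs : s ∈ word n) :
    s ≠ 1 ∧ (s ∈ ({a, b, c, d * b⁻¹} : Set FreeProd) ∨
      s⁻¹ ∈ ({a, b, c, d * b⁻¹} : Set FreeProd)) := by
  have hs' : s = a ∨ s = a⁻¹ ∨ s = c ∨ s = c⁻¹ ∨ s = t ∨ s = t⁻¹ := by
    simp only [word, List.mem_append, List.mem_replicate, List.mem_singleton] at hs
    tauto
  have ha : a ≠ 1 := fun h => of_ne_one (0 : Fin 2) (congrArg Prod.fst h)
  have hc : c ≠ 1 := fun h => of_ne_one (0 : Fin 2) (congrArg Prod.snd h)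
  have ht : t ≠ 1 := fun h => of_ne_one (1 : Fin 2) (by simpa [t, b, d] using congrArg Prod.snd h)
  have ht' : t = d * b⁻¹ := rfl
  rcases hs' with rfl | rfl | rfl | rfl | rfl | rfl <;> simp [ha, hc, ht, ← ht']

/-- For j ≤ n the quotient of the opposite prefixes has exponents j and n - j, with c. For j = n + 1
+ l it has exponents n - l and l, with c⁻¹. -/
theorem le_dist_prod_take_word (n j : ℕ) (hj : j < 2 * n + 2) :
    2 * n + 2 ≤ (SimpleGraph.mulCayley ({a, b, c, d * b⁻¹} : Set FreeProd)).dist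
      ((word n).take j).prod ((word n).take (j + (2 * n + 2))).prod := by
  by_cases hjn : j ≤ n
  · obtain ⟨k, rfl⟩ := Nat.exists_eq_add_of_le hjn
    have e1 : (word (j + k)).take j = List.replicate j t := by
      refine List.take_eq_of_eq_append (l₂ := List.replicate k t ++ [c] ++ List.replicate (j + k) t⁻¹ ++ [a] ++
        List.replicate (j + k) t ++ [c⁻¹] ++ List.replicate (j + k) t⁻¹ ++ [a⁻¹]) ?_ (by simp)
      simp only [word, List.replicate_add, List.append_assoc]
    have e2 : (word (j + k)).take (j + (2 * (j + k) + 2)) =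
        List.replicate (j + k) t ++ [c] ++ List.replicate (j + k) t⁻¹ ++ [a] ++
          List.replicate j t := by
      refine List.take_eq_of_eq_append (l₂ := List.replicate k t ++ [c⁻¹] ++ List.replicate (j + k) t⁻¹ ++
        [a⁻¹]) ?_ (by simp; omega)
      simp only [word, List.replicate_add, List.append_assoc]
    have h := le_dist_self_mul ((word (j + k)).take j).prod j k (z := of 0) (Or.inl rfl)
    have e3 : ((word (j + k)).take j).prod *
        ((of 1 ^ j * of 0 * (of 1 ^ j)⁻¹, of 1 ^ k * of 0 * (of 1 ^ k)⁻¹) : FreeProd) =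
        ((word (j + k)).take (j + (2 * (j + k) + 2))).prod := by
      rw [e1, e2]
      ext
      · simp [t, a, b, c, d]
        group
      · simp [t, a, b, c, d]
        group
    rwa [e3] at h
  · obtain ⟨l, rfl⟩ := Nat.exists_eq_add_of_le (not_le.1 hjn)
    obtain ⟨m, rfl⟩ := Nat.exists_eq_add_of_le (show l ≤ n by omega)
    have e1 : (word (l + m)).take ((l + m).succ + l) =
        List.replicate (l + m) t ++ [c] ++ List.replicate l t⁻¹ := by
      refine List.take_eq_of_eq_append (l₂ := List.replicate m t⁻¹ ++ [a] ++
        List.replicate (l + m) t ++ [c⁻¹] ++ List.replicate (l + m) t⁻¹ ++ [a⁻¹]) ?_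
        (by simp; omega)
      simp only [word, List.replicate_add, List.append_assoc]
    have e2 : (word (l + m)).take ((l + m).succ + l + (2 * (l + m) + 2)) =
        List.replicate (l + m) t ++ [c] ++ List.replicate (l + m) t⁻¹ ++ [a] ++
          List.replicate (l + m) t ++ [c⁻¹] ++ List.replicate l t⁻¹ := by
      refine List.take_eq_of_eq_append (l₂ := List.replicate m t⁻¹ ++ [a⁻¹]) ?_ (by simp; omega)
      simp only [word, List.replicate_add, List.append_assoc]
    have h := le_dist_self_mul ((word (l + m)).take ((l + m).succ + l)).prod m l
      (z := (of 0)⁻¹) (Or.inr rfl)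
    have e3 : ((word (l + m)).take ((l + m).succ + l)).prod *
        ((of 1 ^ m * of 0 * (of 1 ^ m)⁻¹, of 1 ^ l * (of 0)⁻¹ * (of 1 ^ l)⁻¹) : FreeProd) =
        ((word (l + m)).take ((l + m).succ + l + (2 * (l + m) + 2))).prod := by
      rw [e1, e2]
      ext
      · simp [t, a, b, c, d]
        group
      · simp [t, a, b, c, d]
        group
    rw [e3] at h
    omega

theorem definesIsometricCycle_word (n : ℕ) :
    DefinesIsometricCycle (SimpleGraph.mulCayley ({a, b, c, d * b⁻¹} : Set FreeProd)) (word n) :=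
  definesIsometricCycle_of_le_dist (h := 2 * n + 2) (by omega) (by rw [length_word]; ring)
    (prod_word n) (fun _ => mem_word_cases) (le_dist_prod_take_word n)

end FreeProd

theorem theorem1 :
    StronglyShortcut (GraphSpace (SimpleGraph.mulCayley
      ({FreeProd.a, FreeProd.b, FreeProd.c, FreeProd.d} : Set FreeProd))) ∧
    ¬ StronglyShortcut (GraphSpace (SimpleGraph.mulCayley
      ({FreeProd.a, FreeProd.b, FreeProd.c, FreeProd.d * FreeProd.b⁻¹} : Set FreeProd))) ∧
    ∀ n : ℕ, (FreeProd.word n).length = 4 * n + 4 ∧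
      DefinesIsometricCycle (SimpleGraph.mulCayley
        ({FreeProd.a, FreeProd.b, FreeProd.c, FreeProd.d * FreeProd.b⁻¹} : Set FreeProd))
        (FreeProd.word n) := by
  refine ⟨FreeProd.stronglyShortcut_abcd, not_stronglyShortcut_of_isometry_addCircle fun L => ?_,
    fun n => ⟨FreeProd.length_word n, FreeProd.definesIsometricCycle_word n⟩⟩
  obtain ⟨n, hn⟩ := exists_nat_ge L
  obtain ⟨-, γ, hγ, -⟩ := FreeProd.definesIsometricCycle_word n
  refine ⟨(FreeProd.word n).length, ?_, ?_, γ, hγ⟩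
  · rw [FreeProd.length_word]
    push_cast
    linarith [(Nat.cast_nonneg n : (0 : ℝ) ≤ n)]
  · rw [FreeProd.length_word]
    positivity
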